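/- Let $A$ be a finite alphabet. A \emph{finite pattern} is a map $P : D \to A$ with $D \subset \mathbb{Z}^2$ finite; it \emph{occurs} in $x \in A^{\mathbb{Z}^2}$ if for some $v \in \mathbb{Z}^2$ we have $x_{v+w} = P_w$ for all $w \in D$. A \emph{subshift} is a set of the form $\{x \in A^{\mathbb{Z}^2} : \text{no } P \in F \text{ occurs in } x\}$ for a set $F$ of finite patterns. A subshift is $\Pi^0_1$ if its language (the set of finite patterns that occur in at least one of its elements) is $\Pi^0_1$, i.e. co-recursively enumerable. A \emph{u-MSO formula} over $A$ is a formula $$\psi = Q_1 X_1\, Q_2 X_2 \cdots Q_m X_m\, \forall \vec n_1 \cdots \forall \vec n_\ell\ \phi,$$ where each $Q_i \in \{\forall, \exists\}$, the second-order variables $X_i$ range over the binary full shift $\{0,1\}^{\mathbb{Z}^2}$, the first-order variables $\vec n_j$ range over $\mathbb{Z}^2$, and $\phi$ is a Boolean combination of atomic formulas $t = t'$, $P_a(t)$ with $a \in A$ (meaning $x_t = a$ in the configuration $x \in A^{\mathbb{Z}^2}$ under consideration), and $(X_i)_t = b$ with $b \in \{0,1\}$. Here the terms $t, t'$ are obtained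 from first-order variables by repeatedly applying the functions that map $(i,j) \in \mathbb{Z}^2$ to $(i,j+1)$, $(i,j-1)$, $(i+1,j)$ and $(i-1,j)$. The formula defines the set $\mathcal{X}_\psi$ of all $x \in A^{\mathbb{Z}^2}$ in which it is true. If the second-order quantifiers $Q_1 \cdots Q_m$ form exactly $n$ maximal blocks of equal quantifiers, then $\psi$ and $\mathcal{X}_\psi$ are called $\bar\Pi_n$ when the first block is universal, $\bar\Sigma_n$ when it is existential, and both when $n = 0$. \textbf{Theorem.} For every finite alphabet $A$ and every $n \ge 2$, the class $\bar\Pi_n$ of sets $\mathcal{X}_\psi \subset A^{\mathbb{Z}^2}$ equals the class of $\Pi^0_1$ subshifts of $A^{\mathbb{Z}^2}$. Consequently the u-MSO hierarchy collapses: for every $n \ge 3$, the class $\bar\Sigma_n$ also equals the class of $\Pi^0_1$ subshifts of $A^{\mathbb{Z}^2}$. -/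

import Mathlib

universe u

namespace UMSO

/-! ### Patterns and subshifts -/

/-- Configurations over `A`: colorings of the plane `ℤ²` by letters of `A`. -/
abbrev Config (A : Type u) : Type u := ℤ × ℤ → A

/-- Finite patterns over `A`: maps from a finite domain `D ⊂ ℤ²` to `A`. -/
structure FinPattern (A : Type u) where
  dom : Finset (ℤ × ℤ)
  val : dom → A

/-- The pattern `P` occurs in the configuration `x` (at some coordinate `v`). -/
def FinPattern.OccursIn {A : Type u} (P : FinPattern A) (x : Config A) : Prop :=
  ∃ v : ℤ × ℤ, ∀ w : P.dom, x (v + w) = P.val w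

/-- The set of configurations in which no pattern of `F` occurs. -/
def avoiding {A : Type u} (F : Set (FinPattern A)) : Set (Config A) :=
  {x | ∀ P ∈ F, ¬ P.OccursIn x}

/-- A subshift is a set of configurations defined by a set of forbidden finite patterns. -/
def IsSubshift {A : Type u} (X : Set (Config A)) : Prop :=
  ∃ F : Set (FinPattern A), X = avoiding F

/-- The language of `X`: the finite patterns that occur in some element of `X`. -/
def language {A : Type u} (X : Set (Config A)) : Set (FinPattern A) :=
  {P | ∃ x ∈ X, P.OccursIn x}

/-! ### Computability of sets of finite patterns

A finite pattern over a finite alphabet is presented to an algorithm as a list of its cells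
`(coordinate, letter)`, the letters being numbered by `Fin k`. The order of the list and possible
repetitions are irrelevant. -/

/-- `L` is a list of exactly the cells of `P`, with the letters numbered by `e`. -/
def FinPattern.IsCode {A : Type u} {k : ℕ} (e : A ≃ Fin k) (P : FinPattern A)
    (L : List ((ℤ × ℤ) × Fin k)) : Prop :=
  ∀ (v : ℤ × ℤ) (a : A), (v, e a) ∈ L ↔ ∃ h : v ∈ P.dom, P.val ⟨v, h⟩ = a

/-- A set of finite patterns is `Π⁰₁` if (the set of codes of) its complement is recursively
enumerable. The numbering `e` of the alphabet is immaterial, as any two differ by a permutation of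
a finite set. -/
def IsPiZeroOne {A : Type u} (S : Set (FinPattern A)) : Prop :=
  ∃ (k : ℕ) (e : A ≃ Fin k),
    REPred fun L : List ((ℤ × ℤ) × Fin k) => ¬ ∃ P ∈ S, P.IsCode e L

/-- The class of `Π⁰₁` subshifts over `A`: the subshifts whose language is `Π⁰₁`. -/
def piZeroOne (A : Type u) : Set (Set (Config A)) :=
  {X | IsSubshift X ∧ IsPiZeroOne (language X)}

/-! ### u-MSO formulas -/

/-- The four adjacency functions. -/
inductive Dir
  | north
  | south
  | east
  | west

/-- Interpretation of the adjacency functions in `ℤ²`. -/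
def Dir.move : Dir → ℤ × ℤ → ℤ × ℤ
  | .north, (a, b) => (a, b + 1)
  | .south, (a, b) => (a, b - 1)
  | .east, (a, b) => (a + 1, b)
  | .west, (a, b) => (a - 1, b)

/-- Terms in `l` first-order variables: nested applications of adjacency functions to a
first-order variable. -/
inductive Term (l : ℕ)
  | var (i : Fin l)
  | app (d : Dir) (t : Term l)

/-- The value of a term under an assignment of the first-order variables. -/
def Term.eval {l : ℕ} (v : Fin l → ℤ × ℤ) : Term l → ℤ × ℤ
  | .var i => v i
  | .app d t => d.move (t.eval v)

/-- Quantifier-free formulas over the alphabet `A`, with `m` configuration variables over the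
binary full shift and `l` first-order variables. The other connectives are expressible by
`neg`, `and` and `or`. -/
inductive QFFormula (A : Type u) (m l : ℕ)
  /-- the atomic formula `t = t'` -/
  | eq (t t' : Term l)
  /-- the symbol predicate `P_a(t)` -/
  | symb (a : A) (t : Term l)
  /-- the atomic formula `X_t = b`, where `X` is the `j`th configuration variable -/
  | conf (j : Fin m) (t : Term l) (b : Fin 2)
  | neg (φ : QFFormula A m l)
  | and (φ ψ : QFFormula A m l)
  | or (φ ψ : QFFormula A m l)

/-- Truth of a quantifier-free formula in the structure of the configuration `x`, when the
configuration variables have the values `X` and the first-order variables the values `v`. -/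
def QFFormula.Holds {A : Type u} {m l : ℕ} (x : Config A) (X : Fin m → Config (Fin 2))
    (v : Fin l → ℤ × ℤ) : QFFormula A m l → Prop
  | .eq t t' => t.eval v = t'.eval v
  | .symb a t => x (t.eval v) = a
  | .conf j t b => X j (t.eval v) = b
  | .neg φ => ¬ φ.Holds x X v
  | .and φ ψ => φ.Holds x X v ∧ ψ.Holds x X v
  | .or φ ψ => φ.Holds x X v ∨ ψ.Holds x X v

/-- Quantifiers. -/
inductive Quant
  | all
  | ex
  deriving DecidableEq

/-- One quantification over the binary full shift. -/
def Quant.Interp : Quant → (Config (Fin 2) → Prop) → Prop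
  | .all, p => ∀ X, p X
  | .ex, p => ∃ X, p X

/-- The truth value of `Q₁ X₁ Q₂ X₂ ⋯ Qₘ Xₘ p(X₁, …, Xₘ)`, where each `Xᵢ` ranges over the binary
full shift. -/
def quantify : (Q : List Quant) → ((Fin Q.length → Config (Fin 2)) → Prop) → Prop
  | [], p => p Fin.elim0
  | q :: Q, p => q.Interp fun X => quantify Q fun Y => p (Fin.cons X Y)

/-- The number of maximal blocks of equal consecutive quantifiers. -/
def numBlocks : List Quant → ℕ
  | [] => 0
  | [_] => 1
  | q :: r :: Q => if q = r then numBlocks (r :: Q) else numBlocks (r :: Q) + 1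

/-- u-MSO formulas over the alphabet `A`, that is, formulas
`Q₁ X₁[{0,1}^ℤ²] ⋯ Qₘ Xₘ[{0,1}^ℤ²] ∀ n₁ ⋯ ∀ nₗ φ` with `φ` quantifier-free. -/
structure Formula (A : Type u) where
  /-- the second-order quantifiers `Q₁, …, Qₘ` -/
  quants : List Quant
  /-- the number `l` of universally quantified first-order variables -/
  numVars : ℕ
  /-- the quantifier-free part -/
  matrix : QFFormula A quants.length numVars

/-- The configuration `x` models the formula `φ`. -/
def Formula.Models {A : Type u} (φ : Formula A) (x : Config A) : Prop :=
  quantify φ.quants fun X => ∀ v : Fin φ.numVars → ℤ × ℤ, φ.matrix.Holds x X v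

/-- The set of configurations defined by `φ`. -/
def Formula.modelSet {A : Type u} (φ : Formula A) : Set (Config A) :=
  {x | φ.Models x}

/-- `Π̄ₙ` formulas: the second-order quantifiers form `n` alternating blocks, the first of which
(if there is one) is universal. -/
def Formula.IsPiBar {A : Type u} (φ : Formula A) (n : ℕ) : Prop :=
  numBlocks φ.quants = n ∧ φ.quants.head? ≠ some Quant.ex

/-- `Σ̄ₙ` formulas: the second-order quantifiers form `n` alternating blocks, the first of which
(if there is one) is existential. -/
def Formula.IsSigmaBar {A : Type u} (φ : Formula A) (n : ℕ) : Prop :=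
  numBlocks φ.quants = n ∧ φ.quants.head? ≠ some Quant.all

/-- The level `Π̄ₙ` of the u-MSO hierarchy, over the alphabet `A`. -/
def piBar (A : Type u) (n : ℕ) : Set (Set (Config A)) :=
  {X | ∃ φ : Formula A, φ.IsPiBar n ∧ X = φ.modelSet}

/-- The level `Σ̄ₙ` of the u-MSO hierarchy, over the alphabet `A`. -/
def sigmaBar (A : Type u) (n : ℕ) : Set (Set (Config A)) :=
  {X | ∃ φ : Formula A, φ.IsSigmaBar n ∧ X = φ.modelSet}

end UMSO

/-! Definable sets are effectively closed, at every level of the hierarchy. Call a set effectively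
open if membership is witnessed by an initial segment of the configuration that a decidable search
can recognise. The failure of the first-order part is effectively open. Effective openness survives
an existential second-order quantifier (`EffOpen.exists`) and, by compactness of the binary full
shift, a universal one (`EffOpen.forall`). So the complement of a definable set is effectively open.
With shift invariance (`Formula.shift_mem_modelSet`), this makes the set a subshift; one more use of
compactness enumerates the patterns outside its language.

Conversely, let `X` be a `Π⁰₁` subshift. A configuration lies outside `X` iff some quadrant of it
contains a pattern from an enumerable set (`notMem_iff_exists_code`). A nondeterministic register
machine that queries letters of the quadrant accepts exactly in this case (`exists_prog_of_rePred`,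
`Prog.machine_accepts_iff`). It remains to say with one alternation `∀ Y ∃ Z` and a local condition
that no quadrant is accepted (`forall_not_accepts_iff`).

Here `Y` claims to contain accepting runs, drawn in rectangular boxes with time running upwards and
registers stored in unary. `Z` refutes every box: from its lower left corner a path goes east and
north until it finds a violated local rule or a row whose query was answered wrongly. The path may
be infinite, so `Y` must draw finite boxes. To check a query, `Z` draws a vertical line carrying the
expected letter from the mark of register 0. A second vertical line from the mark of register 1
meets the diagonal of a clock register, and from there a horizontal line is drawn. The horizontal
line crosses the first vertical line at the queried cell, where the letter of `x` must differ from
the expected one.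

If some quadrant is accepted, the true tableau has no refutation (`exists_tableau_of_accepts`). If
none is, every error-free box contains a wrong query, and disjointness of boxes lets all refutations
coexist in one `Z` (`exists_search_of_not_accepts`). Binary coding and dummy quantifiers then give
the levels `Π̄ₙ` for `n ≥ 2` and `Σ̄ₙ` for `n ≥ 3` (`mem_levels_of_local`). -/

namespace UMSO

open Function Relation

/-! ### Nondeterministic register programs -/

/-- Contents of the registers. -/
abbrev Store : Type := ℕ → ℕ

/-- Elementary actions: assignments, tests, and a query of a letter of a configuration at the
coordinates stored in the registers `0` and `1`. -/
inductive Act (A : Type u)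
  | assign (b a : ℕ) (sh : Bool)
  | test (a b : ℕ) (r : Bool)
  | query (a : A)

/-- The effect of an action, where `o` answers the queries. -/
def Act.rel {A : Type u} (o : ℕ → ℕ → A) : Act A → Store → Store → Prop
  | .assign b a sh, s, s' => s' = update s b (s a + sh.toNat)
  | .test a b r, s, s' => s' = s ∧ (s a = s b ↔ r = true)
  | .query a, s, s' => s' = s ∧ o (s 0) (s 1) = a

/-- Regular programs. -/
inductive Prog (A : Type u)
  | act (α : Act A)
  | seq (P Q : Prog A)
  | choice (P Q : Prog A)
  | star (P : Prog A)

/-- The input-output relation of a program. -/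
def Prog.rel {A : Type u} (o : ℕ → ℕ → A) : Prog A → Store → Store → Prop
  | .act α => α.rel o
  | .seq P Q => fun s s' => ∃ t, P.rel o s t ∧ Q.rel o t s'
  | .choice P Q => fun s s' => P.rel o s s' ∨ Q.rel o s s'
  | .star P => ReflTransGen (P.rel o)

/-- The registers from `b` on contain zero. -/
def Store.Clean (s : Store) (b : ℕ) : Prop := ∀ r, b ≤ r → s r = 0

/-- `f` is computed by programs: the arguments are found in the registers `ins`, the value is put
into the register `out`, and the scratch registers (from `b` on) are restored to zero. -/
def ProgComputable (A : Type u) {n : ℕ} (f : List.Vector ℕ n →. ℕ) : Prop :=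
  ∀ (ins : Fin n → ℕ) (out b : ℕ), (∀ i, ins i < b) → out < b → ∃ P : Prog A,
    ∀ (o : ℕ → ℕ → A) (s s' : Store), s.Clean b →
      (P.rel o s s' ↔ ∃ m ∈ f (List.Vector.ofFn fun i => s (ins i)), s' = update s out m)

/-! ### Register programs compute all partial recursive functions -/

variable {A : Type u}

theorem ProgComputable.of_eq {n : ℕ} {f g : List.Vector ℕ n →. ℕ} (hf : ProgComputable A f)
    (h : ∀ v, f v = g v) : ProgComputable A g := by
  obtain rfl : f = g := funext h
  exact hf

theorem progComputable_zero : ProgComputable A (n := 0) fun _ => Part.some 0 := by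
  intro ins out b _ _
  -- The scratch register `b` is clean and supplies the constant zero.
  refine ⟨.act (.assign out b false), fun o s s' hs => ?_⟩
  simp [Prog.rel, Act.rel, hs b le_rfl]

theorem progComputable_succ : ProgComputable A (n := 1) fun v => Part.some (Nat.succ v.head) := by
  intro ins out b _ _
  refine ⟨.act (.assign out (ins 0) true), fun o s s' hs => ?_⟩
  simp [Prog.rel, Act.rel]

theorem progComputable_get {n : ℕ} (i : Fin n) :
    ProgComputable A fun v : List.Vector ℕ n => Part.some (v.get i) := by
  intro ins out b _ _
  refine ⟨.act (.assign out (ins i) false), fun o s s' hs => ?_⟩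
  simp [Prog.rel, Act.rel]

/-- A block of registers can be reset. -/
theorem exists_clear_prog (b z : ℕ) (m : ℕ) (hz : b + m ≤ z) : ∃ P : Prog A,
    ∀ (o : ℕ → ℕ → A) (s s' : Store), s z = 0 →
      (P.rel o s s' ↔ s' = fun r => if b ≤ r ∧ r < b + m then 0 else s r) := by
  induction m with
  | zero =>
    refine ⟨.act (.test 0 0 true), fun o s s' _ => ?_⟩
    have : (fun r => if b ≤ r ∧ r < b + 0 then 0 else s r) = s := funext fun r => if_neg (by omega)
    simp only [Prog.rel, Act.rel, this, and_true]
  | succ m ih =>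
    obtain ⟨P, hP⟩ := ih (by omega)
    refine ⟨.seq P (.act (.assign (b + m) z false)), fun o s s' hs => ?_⟩
    simp only [Prog.rel, hP o s _ hs, exists_eq_left, Act.rel]
    have : (update (fun r => if b ≤ r ∧ r < b + m then 0 else s r) (b + m)
        ((if b ≤ z ∧ z < b + m then 0 else s z) + false.toNat)) =
        fun r => if b ≤ r ∧ r < b + (m + 1) then 0 else s r := by
      funext r
      by_cases hr : r = b + m
      · subst hr; simp [hs]
      · rw [update_of_ne hr]
        exact if_congr (by omega) rfl rfl
    rw [this]

theorem _root_.List.Vector.mem_mOfFn_part {α : Type*} {n : ℕ} (f : Fin n → Part α)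
    (v : List.Vector α n) : v ∈ List.Vector.mOfFn f ↔ ∀ i, v.get i ∈ f i := by
  induction n with
  | zero =>
    simp [List.Vector.mOfFn, Part.pure_eq_some, List.Vector.eq_nil v]
  | succ n ih =>
    simp only [List.Vector.mOfFn, Part.bind_eq_bind, Part.mem_bind_iff, Part.pure_eq_some,
      Part.mem_some_iff, ih, Fin.forall_fin_succ]
    constructor
    · rintro ⟨a, ha, w, hw, rfl⟩
      exact ⟨by simpa using ha, fun i => by simpa using hw i⟩
    · rintro ⟨h0, h⟩
      exact ⟨v.head, by simpa using h0, v.tail, fun i => by simpa using h i, by simp⟩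

/-- The inner values are collected in the fresh registers `b`, …, `b + n - 1`, so the arguments stay
intact until all values are known, even if `out` is one of the argument registers. Scratch space of
the subprograms starts at `b + n`, and the block is reset at the end. -/
theorem ProgComputable.comp {m n : ℕ} {f : List.Vector ℕ n →. ℕ}
    {g : Fin n → List.Vector ℕ m →. ℕ}
    (hf : ProgComputable A f) (hg : ∀ i, ProgComputable A (g i)) :
    ProgComputable A fun v => (List.Vector.mOfFn fun i => g i v) >>= f := by
  intro ins out b hins hout
  have key : ∀ j, j ≤ n → ∃ P : Prog A, ∀ (o : ℕ → ℕ → A) (s s' : Store), s.Clean b →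
      (P.rel o s s' ↔ ∃ w : ℕ → ℕ,
        (∀ i : Fin n, i < j → w i ∈ g i (List.Vector.ofFn fun i => s (ins i))) ∧
        s' = fun r => if b ≤ r ∧ r < b + j then w (r - b) else s r) := by
    intro j
    induction j with
    | zero =>
      intro _
      refine ⟨.act (.test 0 0 true), fun o s s' _ => ?_⟩
      have : ∀ w : ℕ → ℕ, (fun r => if b ≤ r ∧ r < b + 0 then w (r - b) else s r) = s :=
        fun w => funext fun r => if_neg (by omega)
      simp only [this]
      simp [Prog.rel, Act.rel]
    | succ j ih =>
      intro hj
      obtain ⟨P, hP⟩ := ih (by omega)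
      obtain ⟨Q, hQ⟩ := hg ⟨j, hj⟩ ins (b + j) (b + n) (fun i => by have := hins i; omega)
        (by omega)
      refine ⟨.seq P Q, fun o s s' hs => ?_⟩
      have hins' : ∀ w : ℕ → ℕ, (fun i => (fun r => if b ≤ r ∧ r < b + j then w (r - b) else s r)
          (ins i)) = fun i => s (ins i) := by
        intro w
        funext i
        have := hins i
        simp only
        rw [if_neg (by omega)]
      have hcl : ∀ w : ℕ → ℕ,
          Store.Clean (fun r => if b ≤ r ∧ r < b + j then w (r - b) else s r) (b + n) := by
        intro w r hr
        simp only
        rw [if_neg (by omega)]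
        exact hs r (by omega)
      simp only [Prog.rel]
      constructor
      · rintro ⟨t, ht, hts⟩
        obtain ⟨w, hw, rfl⟩ := (hP o s _ hs).1 ht
        obtain ⟨k, hk, rfl⟩ := (hQ o _ _ (hcl w)).1 hts
        rw [hins'] at hk
        refine ⟨update w j k, fun i hi => ?_, ?_⟩
        · rcases Nat.lt_succ_iff_lt_or_eq.1 hi with hi | hi
          · rw [update_of_ne hi.ne]; exact hw i hi
          · rw [hi, update_self]
            have : i = ⟨j, hj⟩ := Fin.ext hi
            rw [this]; exact hk
        · funext r
          by_cases hr : r = b + j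
          · subst hr; simp
          · rw [update_of_ne hr]
            by_cases h1 : b ≤ r ∧ r < b + j
            · rw [if_pos h1, if_pos (by omega), update_of_ne (by omega)]
            · rw [if_neg h1, if_neg (by omega)]
      · rintro ⟨w, hw, rfl⟩
        refine ⟨_, (hP o s _ hs).2 ⟨w, fun i hi => hw i (by omega), rfl⟩,
          (hQ o _ _ (hcl w)).2 ⟨w j, ?_, ?_⟩⟩
        · rw [hins']; exact hw ⟨j, hj⟩ (Nat.lt_succ_self j)
        · funext r
          by_cases hr : r = b + j
          · subst hr; simp
          · rw [update_of_ne hr]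
            exact if_congr (by omega) rfl rfl
  obtain ⟨P, hP⟩ := key n le_rfl
  obtain ⟨Q, hQ⟩ := hf (fun i => b + i) out (b + n) (fun i => by simp) (by omega)
  obtain ⟨R, hR⟩ := exists_clear_prog (A := A) b (b + n) n le_rfl
  refine ⟨.seq P (.seq Q R), fun o s s' hs => ?_⟩
  have hcl : ∀ w : ℕ → ℕ,
      Store.Clean (fun r => if b ≤ r ∧ r < b + n then w (r - b) else s r) (b + n) := by
    intro w r hr
    simp only
    rw [if_neg (by omega)]
    exact hs r (by omega)
  have hval : ∀ w : ℕ → ℕ, (fun i : Fin n => (fun r => if b ≤ r ∧ r < b + n then w (r - b) else s r)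
      (b + i)) = fun i : Fin n => w i := by
    intro w
    funext i
    simp
  have hfin : ∀ (w : ℕ → ℕ) (k : ℕ), (fun r => if b ≤ r ∧ r < b + n then 0 else
      update (fun r => if b ≤ r ∧ r < b + n then w (r - b) else s r) out k r) = update s out k := by
    intro w k
    funext r
    by_cases hr : r = out
    · subst hr; rw [if_neg (by omega), update_self, update_self]
    · rw [update_of_ne hr, update_of_ne hr]
      split_ifs with h
      · exact (hs r h.1).symm
      · rfl
  have hz : ∀ (w : ℕ → ℕ) (k : ℕ),
      update (fun r => if b ≤ r ∧ r < b + n then w (r - b) else s r) out k (b + n) = 0 := by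
    intro w k
    rw [update_of_ne (by omega), if_neg (by omega)]
    exact hs _ (by omega)
  have hbind : ∀ k, k ∈ (fun v => (List.Vector.mOfFn fun i => g i v) >>= f)
      (List.Vector.ofFn fun i => s (ins i)) ↔ ∃ v : List.Vector ℕ n,
        (∀ i, v.get i ∈ g i (List.Vector.ofFn fun i => s (ins i))) ∧ k ∈ f v := by
    intro k
    exact Part.mem_bind_iff.trans
      (exists_congr fun v => and_congr_left' (List.Vector.mem_mOfFn_part _ v))
  simp only [Prog.rel, hbind]
  constructor
  · rintro ⟨t, ht, t', htt, hts⟩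
    obtain ⟨w, hw, rfl⟩ := (hP o s _ hs).1 ht
    obtain ⟨k, hk, rfl⟩ := (hQ o _ _ (hcl w)).1 htt
    have := (hR o _ _ (hz w k)).1 hts
    rw [hfin] at this
    rw [hval] at hk
    exact ⟨k, ⟨_, fun i => by simpa using hw i i.2, hk⟩, this⟩
  · rintro ⟨k, ⟨v, hv, hk⟩, rfl⟩
    let w : ℕ → ℕ := fun i => if h : i < n then v.get ⟨i, h⟩ else 0
    have hwv : (List.Vector.ofFn fun i : Fin n => w i) = v := by
      apply List.Vector.ext
      intro i
      simp [w]
    refine ⟨_, (hP o s _ hs).2 ⟨w, fun i _ => by simpa [w] using hv i, rfl⟩, _,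
      (hQ o _ _ (hcl w)).2 ⟨k, ?_, rfl⟩, (hR o _ _ (hz w k)).2 (hfin w k).symm⟩
    rw [hval, hwv]
    exact hk

/-- The states reached by a deterministic loop. -/
theorem reflTransGen_iff_of_det {α : Type*} {R : α → α → Prop} (S : ℕ → α) (c : ℕ → Prop)
    (h : ∀ j t, R (S j) t ↔ c j ∧ t = S (j + 1)) (t : α) :
    ReflTransGen R (S 0) t ↔ ∃ j, (∀ i < j, c i) ∧ t = S j := by
  constructor
  · intro ht
    induction ht with
    | refl => exact ⟨0, by simp, rfl⟩
    | tail _ hst ih =>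
      obtain ⟨j, hj, rfl⟩ := ih
      obtain ⟨hc, rfl⟩ := (h j _).1 hst
      refine ⟨j + 1, fun i hi => ?_, rfl⟩
      rcases Nat.lt_succ_iff_lt_or_eq.1 hi with hi | rfl
      exacts [hj i hi, hc]
  · rintro ⟨j, hj, rfl⟩
    induction j with
    | zero => exact .refl
    | succ j ih =>
      exact (ih fun i hi => hj i (by omega)).tail ((h j _).2 ⟨hj j (by omega), rfl⟩)

/-- Register `b` counts the rounds, `b + 1` holds the current value and `b + 2` is zero. The loop
may be left after any number of rounds; the test against `ins 0` discards every run with the wrong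
number. -/
theorem ProgComputable.prec {n : ℕ} {f : List.Vector ℕ n → ℕ} {g : List.Vector ℕ (n + 2) → ℕ}
    (hf : ProgComputable A fun v => Part.some (f v))
    (hg : ProgComputable A fun v => Part.some (g v)) :
    ProgComputable A fun v : List.Vector ℕ (n + 1) => Part.some
      (v.head.rec (f v.tail) fun y IH => g (y ::ᵥ IH ::ᵥ v.tail)) := by
  intro ins out b hins hout
  obtain ⟨F, hF⟩ := hf (fun i => ins i.succ) (b + 1) (b + 2)
    (fun i => by have := hins i.succ; omega) (by omega)
  obtain ⟨G, hG⟩ := hg (Fin.cons b (Fin.cons (b + 1) fun i => ins i.succ)) (b + 1) (b + 2)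
    (fun i => by
      refine Fin.cases ?_ (fun i => Fin.cases ?_ (fun i => ?_) i) i
      · simp
      · simp
      · have := hins i.succ
        simp only [Fin.cons_succ]; omega) (by omega)
  refine ⟨.seq F (.seq (.star (.seq G (.act (.assign b b true))))
    (.seq (.act (.test b (ins 0) true)) (.seq (.act (.assign out (b + 1) false))
      (.seq (.act (.assign b (b + 2) false)) (.act (.assign (b + 1) (b + 2) false)))))),
    fun o s s' hs => ?_⟩
  set v : List.Vector ℕ n := List.Vector.ofFn fun i => s (ins i.succ) with hv
  let ρ : ℕ → ℕ := fun y => Nat.rec (f v) (fun y IH => g (y ::ᵥ IH ::ᵥ v)) y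
  let S : ℕ → Store := fun j => update (update s b j) (b + 1) (ρ j)
  have hs0 : S 0 = update s (b + 1) (f v) := by
    simp only [S]
    rw [← hs b le_rfl, update_eq_self, hs b le_rfl]
    rfl
  have hSr : ∀ j r, r ≠ b → r ≠ b + 1 → S j r = s r := by
    intro j r h1 h2
    simp only [S]
    rw [update_of_ne h2, update_of_ne h1]
  have hSb : ∀ j, S j b = j := by intro j; simp [S]
  have hSb1 : ∀ j, S j (b + 1) = ρ j := by intro j; simp [S]
  have hcl : ∀ j, (S j).Clean (b + 2) := by
    intro j r hr
    rw [hSr j r (by omega) (by omega)]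
    exact hs r (by omega)
  have hSins : ∀ j (i : Fin (n + 1)), S j (ins i) = s (ins i) := by
    intro j i
    have := hins i
    exact hSr j _ (by omega) (by omega)
  have hstep : ∀ j t, (Prog.seq G (.act (.assign b b true))).rel o (S j) t ↔
      True ∧ t = S (j + 1) := by
    intro j t
    have hvec : (List.Vector.ofFn fun i : Fin (n + 2) => S j ((Fin.cons b
        (Fin.cons (b + 1) fun i => ins i.succ) : Fin (n + 2) → ℕ) i)) = j ::ᵥ ρ j ::ᵥ v := by
      apply List.Vector.ext
      intro i
      refine Fin.cases ?_ (fun i => Fin.cases ?_ (fun i => ?_) i) i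
      · simp [hSb]
      · rw [List.Vector.get_ofFn, Fin.cons_succ, Fin.cons_zero, List.Vector.get_cons_succ,
          List.Vector.get_cons_zero, hSb1]
      · simp [hSins, hv]
    simp only [Prog.rel, hG o _ _ (hcl j), hvec, Part.mem_some_iff, exists_eq_left, true_and,
      Act.rel]
    have : update (update (S j) (b + 1) (g (j ::ᵥ ρ j ::ᵥ v))) b
        (update (S j) (b + 1) (g (j ::ᵥ ρ j ::ᵥ v)) b + true.toNat) = S (j + 1) := by
      rw [update_of_ne (by omega : b ≠ b + 1), hSb]
      funext r
      by_cases h1 : r = b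
      · subst h1; rw [update_self, hSb]; rfl
      · rw [update_of_ne h1]
        by_cases h2 : r = b + 1
        · subst h2; rw [update_self, hSb1]
        · rw [update_of_ne h2, hSr _ _ h1 h2, hSr _ _ h1 h2]
    rw [this]
  have hF' : ∀ t, F.rel o s t ↔ t = S 0 := by
    intro t
    rw [hF o s t (fun r hr => hs r (by omega)), hs0]
    simp [hv]
  have hloop := reflTransGen_iff_of_det S (fun _ => True) hstep
  have hhead : (List.Vector.ofFn fun i => s (ins i)).head = s (ins 0) := by
    rw [← List.Vector.get_zero, List.Vector.get_ofFn]
  have htail : (List.Vector.ofFn fun i => s (ins i)).tail = v := by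
    rw [List.Vector.ofFn, List.Vector.tail_cons]
  have hfin : ∀ j, update (update (update (S j) out (ρ j)) b 0) (b + 1) 0 = update s out (ρ j) := by
    intro j
    funext r
    by_cases h1 : r = b + 1
    · subst h1; rw [update_self, update_of_ne (by omega), hs _ (by omega)]
    by_cases h2 : r = b
    · subst h2; rw [update_of_ne h1, update_self, update_of_ne (by omega), hs _ (by omega)]
    rw [update_of_ne h1, update_of_ne h2]
    by_cases h3 : r = out
    · subst h3; simp
    · rw [update_of_ne h3, update_of_ne h3, hSr j r h2 h1]
  have hz1 : ∀ j, update (S j) out (ρ j) (b + 2) = 0 := by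
    intro j
    rw [update_of_ne (by omega)]
    exact hcl j _ le_rfl
  have hz2 : ∀ j, update (update (S j) out (ρ j)) b 0 (b + 2) = 0 := by
    intro j
    rw [update_of_ne (by omega), hz1]
  beta_reduce
  rw [hhead, htail]
  have hρ : (Nat.rec (f v) (fun y IH => g (y ::ᵥ IH ::ᵥ v)) (s (ins 0)) : ℕ) = ρ (s (ins 0)) := rfl
  rw [hρ]
  constructor
  · rintro ⟨t, ht, t1, ht1, t2, ⟨rfl, ht2⟩, t3, ht3, t4, ht4, ht5⟩
    obtain rfl := (hF' t).1 ht
    obtain ⟨j, -, rfl⟩ := (hloop _).1 ht1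
    simp only [hSb, hSins, iff_true] at ht2
    simp only [Prog.rel, Act.rel, hSb1, Bool.toNat_false, add_zero] at ht3
    subst ht3
    simp only [Prog.rel, Act.rel, hz1, Bool.toNat_false, add_zero] at ht4
    subst ht4
    simp only [Prog.rel, Act.rel, hz2, Bool.toNat_false, add_zero] at ht5
    subst ht5
    exact ⟨_, Part.mem_some _, by rw [hfin, ht2]⟩
  · rintro ⟨m, hm, rfl⟩
    obtain rfl := Part.mem_some_iff.1 hm
    refine ⟨_, (hF' _).2 rfl, _, (hloop _).2 ⟨s (ins 0), by simp, rfl⟩, _,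
      ⟨rfl, by simp [hSb, hSins]⟩, _, rfl, _, rfl, ?_⟩
    simp only [Prog.rel, Act.rel, hSb1, Bool.toNat_false, add_zero, hz1, hz2, hfin]

/-- A round of the loop requires a nonzero value and the exit requires the value zero, so the only
complete run stops at the least zero, and there is none if no zero exists. -/
theorem ProgComputable.rfind {n : ℕ} {f : List.Vector ℕ (n + 1) → ℕ}
    (hf : ProgComputable A fun v => Part.some (f v)) :
    ProgComputable A fun v : List.Vector ℕ n => Nat.rfind fun k =>
      Part.some (decide (f (k ::ᵥ v) = 0)) := by
  intro ins out b hins hout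
  obtain ⟨F, hF⟩ := hf (Fin.cons b fun i => ins i) (b + 1) (b + 2)
    (fun i => by
      refine Fin.cases ?_ (fun i => ?_) i
      · simp
      · have := hins i
        simp only [Fin.cons_succ]; omega) (by omega)
  refine ⟨.seq (.star (.seq F (.seq (.act (.test (b + 1) (b + 2) false))
    (.seq (.act (.assign (b + 1) (b + 2) false)) (.act (.assign b b true))))))
    (.seq F (.seq (.act (.test (b + 1) (b + 2) true)) (.seq (.act (.assign out b false))
      (.act (.assign b (b + 2) false))))), fun o s s' hs => ?_⟩
  set v : List.Vector ℕ n := List.Vector.ofFn fun i => s (ins i) with hv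
  let S : ℕ → Store := fun j => update s b j
  have hs0 : S 0 = s := by
    simp only [S]
    rw [← hs b le_rfl, update_eq_self]
  have hSr : ∀ j r, r ≠ b → S j r = s r := fun j r h1 => update_of_ne h1 _ _
  have hSb : ∀ j, S j b = j := by intro j; simp [S]
  have hcl : ∀ j, (S j).Clean (b + 1) := by
    intro j r hr
    rw [hSr j r (by omega)]
    exact hs r (by omega)
  have hF' : ∀ j t, F.rel o (S j) t ↔ t = update (S j) (b + 1) (f (j ::ᵥ v)) := by
    intro j t
    have hvec : (List.Vector.ofFn fun i : Fin (n + 1) => S j ((Fin.cons b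
        (fun i => ins i) : Fin (n + 1) → ℕ) i)) = j ::ᵥ v := by
      apply List.Vector.ext
      intro i
      refine Fin.cases ?_ (fun i => ?_) i
      · simp [hSb]
      · have := hins i
        simp only [List.Vector.get_ofFn, Fin.cons_succ, List.Vector.get_cons_succ, hv]
        exact hSr j _ (by omega)
    rw [hF o _ _ (fun r hr => hcl j r (by omega)), hvec]
    simp
  have h2 : ∀ j k, update (S j) (b + 1) k (b + 2) = 0 := by
    intro j k
    rw [update_of_ne (by omega)]
    exact hcl j _ (by omega)
  have hreset : ∀ j k, update (update (S j) (b + 1) k) (b + 1) 0 = S j := by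
    intro j k
    rw [update_idem, ← hcl j (b + 1) le_rfl, update_eq_self]
  have hstep : ∀ j t, (Prog.seq F (.seq (.act (.test (b + 1) (b + 2) false))
      (.seq (.act (.assign (b + 1) (b + 2) false)) (.act (.assign b b true))))).rel o (S j) t ↔
      f (j ::ᵥ v) ≠ 0 ∧ t = S (j + 1) := by
    intro j t
    have hnext : update (S j) b (j + 1) = S (j + 1) := update_idem _ _ _
    simp only [Prog.rel, hF', exists_eq_left, Act.rel, h2, update_self, and_assoc,
      Bool.toNat_false, add_zero, hreset, hSb, Bool.toNat_true, hnext, Bool.false_eq_true,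
      iff_false, ne_eq]
  have hloop := reflTransGen_iff_of_det S (fun j => f (j ::ᵥ v) ≠ 0) hstep s'
  have hfin : ∀ j, update (update (S j) out j) b 0 = update s out j := by
    intro j
    funext r
    by_cases h2 : r = b
    · subst h2; rw [update_self, update_of_ne (by omega), hs _ (by omega)]
    rw [update_of_ne h2]
    by_cases h3 : r = out
    · subst h3; simp
    · rw [update_of_ne h3, update_of_ne h3, hSr j r h2]
  have hrest : ∀ j t, (Prog.seq F (.seq (.act (.test (b + 1) (b + 2) true))
      (.seq (.act (.assign out b false)) (.act (.assign b (b + 2) false))))).rel o (S j) t ↔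
      f (j ::ᵥ v) = 0 ∧ t = update s out j := by
    intro j t
    simp only [Prog.rel, hF', exists_eq_left, Act.rel, h2, update_self, and_assoc, iff_true,
      Bool.toNat_false, add_zero]
    refine and_congr_right fun h0 => ?_
    have : update (S j) (b + 1) (f (j ::ᵥ v)) = S j := by
      rw [h0, ← hcl j (b + 1) le_rfl, update_eq_self]
    rw [this, update_of_ne (by omega : b + 2 ≠ out), hSb, hcl j (b + 2) (by omega), hfin]
  have hmem : ∀ j, j ∈ (Nat.rfind fun k => (Part.some (decide (f (k ::ᵥ v) = 0)))) ↔
      f (j ::ᵥ v) = 0 ∧ ∀ i < j, f (i ::ᵥ v) ≠ 0 := by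
    intro j
    refine Nat.mem_rfind.trans ?_
    simp
  simp only [hmem]
  rw [Prog.rel]
  constructor
  · rintro ⟨t, ht, hts⟩
    rw [← hs0] at ht
    obtain ⟨j, hj, rfl⟩ := (reflTransGen_iff_of_det S (fun j => f (j ::ᵥ v) ≠ 0) hstep t).1 ht
    obtain ⟨h0, rfl⟩ := (hrest j _).1 hts
    exact ⟨j, ⟨h0, hj⟩, rfl⟩
  · rintro ⟨j, ⟨h0, hj⟩, rfl⟩
    refine ⟨S j, ?_, (hrest j _).2 ⟨h0, rfl⟩⟩
    rw [← hs0]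
    exact (reflTransGen_iff_of_det S (fun j => f (j ::ᵥ v) ≠ 0) hstep _).2 ⟨j, hj, rfl⟩

theorem progComputable_of_primrec' {n : ℕ} {f : List.Vector ℕ n → ℕ} (hf : Nat.Primrec' f) :
    ProgComputable A fun v => Part.some (f v) := by
  induction hf with
  | zero => exact progComputable_zero
  | succ => exact progComputable_succ
  | get i => exact progComputable_get i
  | comp g hf hg ihf ihg =>
    exact (ihf.comp ihg).of_eq fun v => by
      rw [_root_.Vector.mOfFn_part_some]
      exact Part.bind_some _ _
  | prec hf hg ihf ihg => exact ihf.prec ihg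

theorem progComputable_of_partrec' {n : ℕ} {f : List.Vector ℕ n →. ℕ} (hf : Nat.Partrec' f) :
    ProgComputable A f := by
  induction hf with
  | prim hf => exact progComputable_of_primrec' hf
  | comp g hf hg ihf ihg => exact ihf.comp ihg
  | rfind hf ih => exact ih.rfind

end UMSO

namespace UMSO

open Function Relation

variable {A : Type u}

/-! ### Finite automata controlling register programs -/

/-- A finite automaton whose transitions are labelled by actions. -/
structure Machine (A : Type u) where
  State : Type u
  Label : Type u
  [finState : Finite State]
  [finLabel : Finite Label]
  act : Label → Act A
  step : State → Label → State → Prop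
  start : State
  final : State

/-- One step of a machine. -/
def Machine.Next (M : Machine A) (o : ℕ → ℕ → A) (c c' : M.State × Store) : Prop :=
  ∃ i, M.step c.1 i c'.1 ∧ (M.act i).rel o c.2 c'.2

/-- The machine has an accepting run from the empty store. -/
def Machine.Accepts (M : Machine A) (o : ℕ → ℕ → A) : Prop :=
  ∃ s, ReflTransGen (M.Next o) (M.start, fun _ => 0) (M.final, s)

/-- The action without effect. -/
def Act.skip : Act A := .test 0 0 true

theorem Act.rel_skip (o : ℕ → ℕ → A) (s s' : Store) : Act.skip.rel o s s' ↔ s' = s := by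
  simp [Act.skip, Act.rel]

/-- The steps of the abstract machine that works off a stack of programs. -/
inductive Prog.Step : List (Prog A) → Act A → List (Prog A) → Prop
  | act (α k) : Step (.act α :: k) α k
  | seq (P Q k) : Step (.seq P Q :: k) .skip (P :: Q :: k)
  | left (P Q k) : Step (.choice P Q :: k) .skip (P :: k)
  | right (P Q k) : Step (.choice P Q :: k) .skip (Q :: k)
  | exit (P k) : Step (.star P :: k) .skip k
  | loop (P k) : Step (.star P :: k) .skip (P :: .star P :: k)

/-- Steps on stacks of programs and stores. -/
def Prog.Next (o : ℕ → ℕ → A) (c c' : List (Prog A) × Store) : Prop :=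
  ∃ α, Prog.Step c.1 α c'.1 ∧ α.rel o c.2 c'.2

theorem Prog.reflTransGen_of_rel (o : ℕ → ℕ → A) (P : Prog A) (k : List (Prog A)) (s s' : Store)
    (h : P.rel o s s') : ReflTransGen (Prog.Next o) (P :: k, s) (k, s') := by
  induction P generalizing k s s' with
  | act α => exact .single ⟨α, .act α k, h⟩
  | seq P Q ihP ihQ =>
    obtain ⟨t, hP, hQ⟩ := h
    exact .head ⟨_, .seq P Q k, (Act.rel_skip o s s).2 rfl⟩
      ((ihP (Q :: k) s t hP).trans (ihQ k t s' hQ))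
  | choice P Q ihP ihQ =>
    rcases h with h | h
    · exact .head ⟨_, .left P Q k, (Act.rel_skip o s s).2 rfl⟩ (ihP k s s' h)
    · exact .head ⟨_, .right P Q k, (Act.rel_skip o s s).2 rfl⟩ (ihQ k s s' h)
  | star P ih =>
    change ReflTransGen _ s s' at h
    induction h using ReflTransGen.head_induction_on with
    | refl => exact .single ⟨_, .exit P k, (Act.rel_skip o s' s').2 rfl⟩
    | head hst _ ih' =>
      exact .head (b := (P :: .star P :: k, _)) ⟨_, .loop P k, (Act.rel_skip o _ _).2 rfl⟩
        ((ih _ _ _ hst).trans ih')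

/-- The relation of a stack of programs. -/
def Prog.stackRel (o : ℕ → ℕ → A) : List (Prog A) → Store → Store → Prop
  | [], s, s' => s' = s
  | P :: k, s, s' => ∃ t, P.rel o s t ∧ Prog.stackRel o k t s'

theorem Prog.stackRel_of_reflTransGen (o : ℕ → ℕ → A) {c : List (Prog A) × Store} {s' : Store}
    (h : ReflTransGen (Prog.Next o) c ([], s')) : Prog.stackRel o c.1 c.2 s' := by
  induction h using ReflTransGen.head_induction_on with
  | refl => rfl
  | @head c c' hst _ ih =>
    obtain ⟨k, s⟩ := c
    obtain ⟨k', t⟩ := c'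
    obtain ⟨α, hstep, hα⟩ := hst
    cases hstep with
    | act => exact ⟨t, hα, ih⟩
    | seq =>
      obtain rfl := (Act.rel_skip o _ _).1 hα
      obtain ⟨t1, h1, t2, h2, h3⟩ := ih
      exact ⟨t2, ⟨t1, h1, h2⟩, h3⟩
    | left =>
      obtain rfl := (Act.rel_skip o _ _).1 hα
      obtain ⟨t1, h1, h2⟩ := ih
      exact ⟨t1, .inl h1, h2⟩
    | right =>
      obtain rfl := (Act.rel_skip o _ _).1 hα
      obtain ⟨t1, h1, h2⟩ := ih
      exact ⟨t1, .inr h1, h2⟩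
    | exit =>
      obtain rfl := (Act.rel_skip o _ _).1 hα
      exact ⟨t, .refl, ih⟩
    | loop =>
      obtain rfl := (Act.rel_skip o _ _).1 hα
      obtain ⟨t1, h1, t2, h2, h3⟩ := ih
      exact ⟨t2, .head h1 h2, h3⟩

/-- A set of stacks that contains those reached from `[P]`. -/
def Prog.stacks : Prog A → Set (List (Prog A))
  | .act α => {[.act α], []}
  | .seq P Q => {[.seq P Q]} ∪ (· ++ [Q]) '' P.stacks ∪ Q.stacks
  | .choice P Q => {[.choice P Q]} ∪ P.stacks ∪ Q.stacks
  | .star P => {[.star P], []} ∪ (· ++ [.star P]) '' P.stacks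

/-- The actions in a program, and the one without effect. -/
def Prog.acts : Prog A → Set (Act A)
  | .act α => {α, .skip}
  | .seq P Q => P.acts ∪ Q.acts
  | .choice P Q => P.acts ∪ Q.acts
  | .star P => P.acts

theorem Prog.finite_stacks (P : Prog A) : P.stacks.Finite := by
  induction P with
  | act α => simp [Prog.stacks]
  | seq P Q ihP ihQ => exact ((Set.finite_singleton _).union (ihP.image _)).union ihQ
  | choice P Q ihP ihQ => exact ((Set.finite_singleton _).union ihP).union ihQ
  | star P ih => exact (Set.toFinite _).union (ih.image _)

theorem Prog.finite_acts (P : Prog A) : P.acts.Finite := by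
  induction P with
  | act α => simp [Prog.acts]
  | seq P Q ihP ihQ => exact ihP.union ihQ
  | choice P Q ihP ihQ => exact ihP.union ihQ
  | star P ih => exact ih

theorem Prog.skip_mem_acts (P : Prog A) : Act.skip ∈ P.acts := by
  induction P with
  | act α => simp [Prog.acts]
  | seq P Q ihP ihQ => exact .inl ihP
  | choice P Q ihP ihQ => exact .inl ihP
  | star P ih => exact ih

theorem Prog.singleton_mem_stacks (P : Prog A) : [P] ∈ P.stacks := by
  cases P <;> simp [Prog.stacks]

theorem Prog.nil_mem_stacks (P : Prog A) : [] ∈ P.stacks := by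
  induction P with
  | act α => simp [Prog.stacks]
  | seq P Q ihP ihQ => exact .inr ihQ
  | choice P Q ihP ihQ => exact .inr ihQ
  | star P ih => simp [Prog.stacks]

theorem Prog.Step.of_append {k l k' : List (Prog A)} {α : Act A} (hk : k ≠ [])
    (h : Prog.Step (k ++ l) α k') : ∃ k'', k' = k'' ++ l ∧ Prog.Step k α k'' := by
  obtain ⟨P, k, rfl⟩ := List.exists_cons_of_ne_nil hk
  rw [List.cons_append] at h
  cases h with
  | act => exact ⟨_, rfl, .act _ _⟩
  | seq P Q => exact ⟨P :: Q :: k, rfl, .seq _ _ _⟩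
  | left P Q => exact ⟨P :: k, rfl, .left _ _ _⟩
  | right P Q => exact ⟨Q :: k, rfl, .right _ _ _⟩
  | exit => exact ⟨k, rfl, .exit _ _⟩
  | loop P => exact ⟨P :: .star P :: k, rfl, .loop _ _⟩

/-- This closure property makes the control finite: a stack that arises is a stack of a subprogram
followed by a fixed remainder, and by `finite_stacks` there are finitely many of these. -/
theorem Prog.Step.mem_stacks {P : Prog A} {k k' : List (Prog A)} {α : Act A}
    (h : Prog.Step k α k') (hk : k ∈ P.stacks) : k' ∈ P.stacks ∧ α ∈ P.acts := by
  induction P generalizing k k' α with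
  | act β =>
    rcases hk with rfl | rfl
    · cases h; simp [Prog.stacks, Prog.acts]
    · cases h
  | seq P Q ihP ihQ =>
    rcases hk with (rfl | ⟨l, hl, rfl⟩) | hk
    · cases h
      exact ⟨.inl (.inr ⟨[P], P.singleton_mem_stacks, rfl⟩), .inl P.skip_mem_acts⟩
    -- When `P` is used up, the stack is `[Q]`, which is already among the stacks of `Q`.
    · by_cases hn : l = []
      · subst hn
        have := ihQ h Q.singleton_mem_stacks
        exact ⟨.inr this.1, .inr this.2⟩
      · obtain ⟨k'', rfl, h''⟩ := h.of_append hn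
        have := ihP h'' hl
        exact ⟨.inl (.inr ⟨k'', this.1, rfl⟩), .inl this.2⟩
    · have := ihQ h hk
      exact ⟨.inr this.1, .inr this.2⟩
  | choice P Q ihP ihQ =>
    rcases hk with (rfl | hk) | hk
    · cases h
      · exact ⟨.inl (.inr P.singleton_mem_stacks), .inl P.skip_mem_acts⟩
      · exact ⟨.inr Q.singleton_mem_stacks, .inl P.skip_mem_acts⟩
    · have := ihP h hk
      exact ⟨.inl (.inr this.1), .inl this.2⟩
    · have := ihQ h hk
      exact ⟨.inr this.1, .inr this.2⟩
  | star P ih =>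
    have hstar : ∀ {k' α}, Prog.Step [.star P] α k' →
        k' ∈ (Prog.star P).stacks ∧ α ∈ (Prog.star P).acts := by
      intro k' α h
      cases h
      · exact ⟨Prog.nil_mem_stacks _, P.skip_mem_acts⟩
      · exact ⟨.inr ⟨[P], P.singleton_mem_stacks, rfl⟩, P.skip_mem_acts⟩
    rcases hk with (rfl | rfl) | ⟨l, hl, rfl⟩
    · exact hstar h
    · cases h
    · by_cases hn : l = []
      · subst hn
        exact hstar h
      · obtain ⟨k'', rfl, h''⟩ := h.of_append hn
        have := ih h'' hl
        exact ⟨.inr ⟨k'', this.1, rfl⟩, this.2⟩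

/-- The automaton of a program. -/
def Prog.machine (P : Prog A) : Machine A where
  State := P.stacks
  Label := P.acts
  finState := P.finite_stacks
  finLabel := P.finite_acts
  act := Subtype.val
  step k α k' := Prog.Step k.1 α.1 k'.1
  start := ⟨[P], P.singleton_mem_stacks⟩
  final := ⟨[], P.nil_mem_stacks⟩

theorem Prog.machine_accepts_iff (P : Prog A) (o : ℕ → ℕ → A) :
    P.machine.Accepts o ↔ ∃ s, P.rel o (fun _ => 0) s := by
  refine exists_congr fun s => ⟨fun h => ?_, fun h => ?_⟩
  · have h' : ReflTransGen (Prog.Next o) ([P], fun _ => 0) ([], s) :=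
      h.lift (fun c => (c.1.1, c.2)) fun c c' ⟨i, h1, h2⟩ => ⟨i.1, h1, h2⟩
    obtain ⟨t, ht, rfl⟩ := Prog.stackRel_of_reflTransGen o h'
    exact ht
  · have h' := Prog.reflTransGen_of_rel o P [] _ s h
    have key : ∀ c : List (Prog A) × Store, ReflTransGen (Prog.Next o) ([P], fun _ => 0) c →
        ∃ hc : c.1 ∈ P.stacks, ReflTransGen (P.machine.Next o) (P.machine.start, fun _ => 0)
          (⟨c.1, hc⟩, c.2) := by
      intro c hc
      induction hc with
      | refl => exact ⟨P.singleton_mem_stacks, .refl⟩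
      | tail _ hst ih =>
        obtain ⟨hc, hr⟩ := ih
        obtain ⟨α, h1, h2⟩ := hst
        obtain ⟨m1, m2⟩ := h1.mem_stacks hc
        exact ⟨m1, hr.tail ⟨⟨α, m2⟩, h1, h2⟩⟩
    exact (key _ h').2

/-! ### A program that looks for a pattern of a recursively enumerable set -/

theorem exists_choice_prog (l : List (Prog A)) : ∃ P : Prog A, ∀ (o : ℕ → ℕ → A) (s s' : Store),
    P.rel o s s' ↔ ∃ Q ∈ l, Q.rel o s s' := by
  induction l with
  -- The empty choice has to fail: a register never differs from itself.
  | nil => exact ⟨.act (.test 0 0 false), by simp [Prog.rel, Act.rel]⟩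
  | cons Q l ih =>
    obtain ⟨P, hP⟩ := ih
    exact ⟨.choice Q P, fun o s s' => by simp [Prog.rel, hP]⟩

/-- The `i`th entry of the list with the code `N`. -/
def codedEntry (α : Type*) [Primcodable α] (N i : ℕ) : Option α :=
  (Encodable.decode (α := List α) N).bind fun L => L[i]?

theorem primrec_codedEntry (α : Type*) [Primcodable α] :
    Primrec fun v : List.Vector ℕ 2 => codedEntry α (v.get 0) (v.get 1) := by
  have hget : ∀ i : Fin 2, Primrec fun v : List.Vector ℕ 2 => v.get i :=
    fun i => Primrec.vector_get.comp .id (.const i)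
  exact Primrec.option_bind (Primrec.decode.comp (hget 0))
    (Primrec.list_getElem?.comp .snd ((hget 1).comp .fst))

/-- Defined if `N` is the code of a list of length `i` with the property `W`. -/
def codeCheck {α : Type*} [Primcodable α] (W : List α → Prop) (N i : ℕ) : Part ℕ :=
  (Part.ofOption (Encodable.decode (α := List α) N)).bind fun L =>
    (Part.assert (W L) fun _ => Part.some ()).bind fun _ =>
      Part.ofOption (if L.length = i then some 0 else none)

theorem partrec_codeCheck {α : Type*} [Primcodable α] {W : List α → Prop} (hW : REPred W) :
    Partrec fun v : List.Vector ℕ 2 => codeCheck W (v.get 0) (v.get 1) := by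
  have hget : ∀ i : Fin 2, Primrec fun v : List.Vector ℕ 2 => v.get i :=
    fun i => Primrec.vector_get.comp .id (.const i)
  have h1 : Computable fun v : List.Vector ℕ 2 => Encodable.decode (α := List α) (v.get 0) :=
    (Primrec.decode.comp (hget 0)).to_comp
  have h2 : Computable fun p : (List.Vector ℕ 2 × List α) × Unit =>
      (if p.1.2.length = p.1.1.get 1 then some 0 else none : Option ℕ) := by
    refine Primrec.to_comp (Primrec.ite ?_ (.const _) (.const _))
    exact Primrec.eq.comp (Primrec.list_length.comp (Primrec.snd.comp .fst))
      ((hget 1).comp (Primrec.fst.comp .fst))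
  exact Partrec.bind h1.ofOption (Partrec.bind (Partrec.comp hW Computable.snd) h2.ofOption)

theorem exists_mem_codeCheck_iff {α : Type*} [Primcodable α] (W : List α → Prop) (N i : ℕ) :
    (∃ m, m ∈ codeCheck W N i) ↔ ∃ L, Encodable.decode (α := List α) N = some L ∧ W L ∧
      L.length = i := by
  simp only [codeCheck, Part.mem_bind_iff, Part.mem_ofOption, Part.mem_assert_iff]
  constructor
  · rintro ⟨m, L, hL, -, ⟨hW, -⟩, hm⟩
    refine ⟨L, hL, hW, ?_⟩
    by_contra h
    simp [h] at hm
  · rintro ⟨L, hL, hW, hl⟩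
    exact ⟨0, L, hL, (), ⟨hW, Part.mem_some _⟩, by simp [hl]⟩

/-- The program guesses the code `N` of a list, compares the entries one after another with the
oracle, and finally runs the semidecision procedure for `W`. Register 2 holds `N`, 3 the index of
the entry, 0 and 1 the coordinates to be queried, 4 and 5 results of subprograms, and 6 stays zero.
-/
theorem exists_prog_of_rePred [Finite A] {k : ℕ} (e : A ≃ Fin k)
    {W : List ((ℕ × ℕ) × Fin k) → Prop} (hW : REPred W) :
    ∃ P : Prog A, ∀ o : ℕ → ℕ → A, (∃ s, P.rel o (fun _ => 0) s) ↔
      ∃ L, W L ∧ ∀ c ∈ L, e (o c.1.1 c.1.2) = c.2 := by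
  classical
  let E : ℕ → ℕ → Option ((ℕ × ℕ) × Fin k) := codedEntry _
  have hE : Primrec fun v : List.Vector ℕ 2 => E (v.get 0) (v.get 1) := primrec_codedEntry _
  let f₀ : ℕ → ℕ → ℕ := fun N i => ((E N i).map fun c => c.1.1).getD 0
  let f₁ : ℕ → ℕ → ℕ := fun N i => ((E N i).map fun c => c.1.2).getD 0
  let g : A → ℕ → ℕ → ℕ := fun a N i => if (E N i).map Prod.snd = some (e a) then 0 else 1
  have hf₀ : Primrec fun v : List.Vector ℕ 2 => f₀ (v.get 0) (v.get 1) :=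
    Primrec.option_getD.comp (Primrec.option_map hE
      ((Primrec.fst.comp (Primrec.fst.comp .snd)).to₂)) (.const 0)
  have hf₁ : Primrec fun v : List.Vector ℕ 2 => f₁ (v.get 0) (v.get 1) :=
    Primrec.option_getD.comp (Primrec.option_map hE
      ((Primrec.snd.comp (Primrec.fst.comp .snd)).to₂)) (.const 0)
  have hg : ∀ a, Primrec fun v : List.Vector ℕ 2 => g a (v.get 0) (v.get 1) := fun a =>
    Primrec.ite (Primrec.eq.comp (Primrec.option_map hE (Primrec.snd.comp .snd).to₂)
      (.const _)) (.const 0) (.const 1)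
  have comp := fun {f : List.Vector ℕ 2 → ℕ} (hf : Primrec f) (out : ℕ) (ho : out < 6) =>
    progComputable_of_primrec' (A := A) (Nat.Primrec'.of_prim hf) ![2, 3] out 6
      (by intro i; fin_cases i <;> simp) ho
  obtain ⟨F₀, hF₀⟩ := comp hf₀ 0 (by omega)
  obtain ⟨F₁, hF₁⟩ := comp hf₁ 1 (by omega)
  choose G hG using fun a => comp (hg a) 4 (by omega)
  obtain ⟨H, hH⟩ := progComputable_of_partrec' (A := A) (Nat.Partrec'.of_part
    (partrec_codeCheck hW)) ![2, 3] 5 6 (by intro i; fin_cases i <;> simp) (by omega)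
  simp only [List.Vector.get_ofFn, Matrix.cons_val_zero, Matrix.cons_val_one,
    Part.mem_some_iff, exists_eq_left] at hF₀ hF₁ hG hH
  -- A query names its letter, so there is one body per letter `a`; `g a` vanishes only if the
  -- current entry exists and has this letter.
  let body : A → Prog A := fun a => .seq F₀ (.seq F₁ (.seq (G a) (.seq (.act (.test 4 6 true))
    (.seq (.act (.query a)) (.seq (.act (.assign 4 6 false)) (.seq (.act (.assign 0 6 false))
    (.seq (.act (.assign 1 6 false)) (.act (.assign 3 3 true)))))))))
  have := Fintype.ofFinite A
  obtain ⟨C, hC⟩ := exists_choice_prog ((Finset.univ : Finset A).toList.map body)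
  have hC' : ∀ o s s', C.rel o s s' ↔ ∃ a, (body a).rel o s s' := by
    intro o s s'
    rw [hC]
    simp
  -- Both loops can be left at any time, but `H` only halts if the final index is the length of the
  -- list, hence all entries have been compared.
  refine ⟨.seq (.star (.act (.assign 2 2 true))) (.seq (.star C) H), fun o => ?_⟩
  let S : ℕ → ℕ → Store := fun N j => update (update (fun _ => 0) 2 N) 3 j
  have hinc : ∀ t, (Prog.star (.act (.assign 2 2 true))).rel o (fun _ => 0) t ↔
      ∃ N, t = S N 0 := by
    intro t
    have h0 : ∀ N, S N 0 = update (fun _ => 0) 2 N := by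
      intro N
      exact update_eq_self_iff.2 (by simp)
    simp only [h0]
    have := reflTransGen_iff_of_det (R := (Prog.act (.assign 2 2 true)).rel o)
      (fun N => update (fun _ => 0) 2 N) (fun _ => True) (fun j t => by
        simp [Prog.rel, Act.rel]) t
    simp only [implies_true, true_and] at this
    rw [← this]
    have h00 : update (fun _ => 0) 2 0 = (fun _ => 0 : ℕ → ℕ) := update_eq_self_iff.2 rfl
    rw [h00]
    rfl
  have hbody : ∀ N j a t, (body a).rel o (S N j) t ↔
      (g a N j = 0 ∧ o (f₀ N j) (f₁ N j) = a) ∧ t = S N (j + 1) := by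
    intro N j a t
    have c0 : (S N j).Clean 6 := fun r hr => by
      simp only [S]; rw [update_of_ne (by omega), update_of_ne (by omega)]
    have c1 : ∀ x, Store.Clean (update (S N j) 0 x) 6 := fun x r hr => by
      rw [update_of_ne (by omega)]; exact c0 r hr
    have c2 : ∀ x y, Store.Clean (update (update (S N j) 0 x) 1 y) 6 := fun x y r hr => by
      rw [update_of_ne (by omega)]; exact c1 x r hr
    have s2 : S N j 2 = N := by simp [S]
    have s3 : S N j 3 = j := by simp [S]
    have s6 : S N j 6 = 0 := c0 6 le_rfl
    have hfin : ∀ x y z, update (update (update (update (update (update (update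
        (S N j) 0 x) 1 y) 4 z) 4 0) 0 0) 1 0) 3 (j + 1) = S N (j + 1) := by
      intro x y z
      funext r
      by_cases h3 : r = 3
      · subst h3; simp [S]
      by_cases h1 : r = 1
      · subst h1; simp [S]
      by_cases h0 : r = 0
      · subst h0; simp [S]
      by_cases h4 : r = 4
      · subst h4; simp [S]
      simp [S, h3, h1, h0, h4]
    simp only [body, Prog.rel, hF₀ o _ _ c0, exists_eq_left, hF₁ o _ _ (c1 _),
      hG a o _ _ (c2 _ _), Act.rel, and_assoc, iff_true, Bool.toNat_false, Bool.toNat_true,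
      add_zero]
    simp only [ne_eq, OfNat.ofNat_ne_zero, OfNat.ofNat_ne_one, not_false_eq_true, update_of_ne,
      update_self, s2, s3, s6, Nat.reduceEqDiff, OfNat.zero_ne_ofNat, OfNat.one_ne_ofNat,
      zero_ne_one, hfin]
  have hloop : ∀ N t, (Prog.star C).rel o (S N 0) t ↔ ∃ j,
      (∀ i < j, ∃ a, g a N i = 0 ∧ o (f₀ N i) (f₁ N i) = a) ∧ t = S N j := by
    intro N t
    refine reflTransGen_iff_of_det (S N) _ (fun j t => ?_) t
    rw [hC']
    simp only [hbody]
    exact exists_and_right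
  have hHS : ∀ N j t, H.rel o (S N j) t ↔ ∃ m ∈ codeCheck W N j, t = update (S N j) 5 m := by
    intro N j t
    have c0 : (S N j).Clean 6 := fun r hr => by
      simp only [S]; rw [update_of_ne (by omega), update_of_ne (by omega)]
    rw [hH o _ _ c0]
    simp [S]
  have hmatch : ∀ N i, (∃ a, g a N i = 0 ∧ o (f₀ N i) (f₁ N i) = a) ↔
      ∃ c, E N i = some c ∧ e (o c.1.1 c.1.2) = c.2 := by
    intro N i
    simp only [g, f₀, f₁, ite_eq_left_iff, one_ne_zero, imp_false, not_not]
    cases h : E N i with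
    | none => simp
    | some c => simp [eq_comm]
  constructor
  · rintro ⟨s, t, ht, t', ht', hs⟩
    obtain ⟨N, rfl⟩ := (hinc t).1 ht
    obtain ⟨j, hj, rfl⟩ := (hloop N t').1 ht'
    obtain ⟨m, hm, rfl⟩ := (hHS N j s).1 hs
    obtain ⟨L, hL, hWL, hlen⟩ := (exists_mem_codeCheck_iff W N j).1 ⟨m, hm⟩
    refine ⟨L, hWL, fun c hc => ?_⟩
    obtain ⟨i, hi, rfl⟩ := List.getElem_of_mem hc
    obtain ⟨c, h1, h2⟩ := (hmatch N i).1 (hj i (by omega))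
    simp only [E, codedEntry, hL, Option.bind_some, List.getElem?_eq_getElem hi,
      Option.some.injEq] at h1
    rw [h1]; exact h2
  · rintro ⟨L, hWL, hL⟩
    obtain ⟨m, hm⟩ := (exists_mem_codeCheck_iff W (Encodable.encode L) L.length).2
      ⟨L, Encodable.encodek L, hWL, rfl⟩
    refine ⟨_, _, (hinc _).2 ⟨Encodable.encode L, rfl⟩, _, (hloop _ _).2
      ⟨L.length, fun i hi => (hmatch _ i).2 ⟨L[i], ?_, hL _ (List.getElem_mem hi)⟩, rfl⟩,
      (hHS _ _ _).2 ⟨m, hm, rfl⟩⟩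
    simp [E, codedEntry, hi]

end UMSO

namespace UMSO

open Function Relation

variable {A : Type u}

/-! ### Effect of an action on single registers -/

/-- The register that a register is copied from. -/
def Act.src : Act A → ℕ → ℕ
  | .assign b a _, r => if r = b then a else r
  | .test _ _ _, r => r
  | .query _, r => r

/-- Is the register incremented (after copying)? -/
def Act.inc : Act A → ℕ → Bool
  | .assign b _ sh, r => if r = b then sh else false
  | .test _ _ _, _ => false
  | .query _, _ => false

/-- The condition under which an action can be performed. -/
def Act.Guard (o : ℕ → ℕ → A) (s : Store) : Act A → Prop
  | .assign _ _ _ => True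
  | .test a b r => s a = s b ↔ r = true
  | .query a => o (s 0) (s 1) = a

/-- The store after an action. -/
def Act.apply (α : Act A) (s : Store) : Store := fun r => s (α.src r) + (α.inc r).toNat

theorem Act.rel_iff (o : ℕ → ℕ → A) (α : Act A) (s s' : Store) :
    α.rel o s s' ↔ s' = α.apply s ∧ α.Guard o s := by
  cases α with
  | assign b a sh =>
    have : update s b (s a + sh.toNat) = (Act.assign b a sh : Act A).apply s := by
      funext r
      by_cases h : r = b
      · subst h; simp [Act.apply, Act.src, Act.inc]
      · simp [Act.apply, Act.src, Act.inc, h]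
    simp [Act.rel, Act.Guard, this]
  | test a b r =>
    have : (Act.test a b r : Act A).apply s = s := by
      funext r; simp [Act.apply, Act.src, Act.inc]
    simp [Act.rel, Act.Guard, this]
  | query a =>
    have : (Act.query a : Act A).apply s = s := by
      funext r; simp [Act.apply, Act.src, Act.inc]
    simp [Act.rel, Act.Guard, this]

/-- All registers in the action have an index below `K`. -/
def Act.Below (K : ℕ) : Act A → Prop
  | .assign b a _ => b < K ∧ a < K
  | .test a b _ => a < K ∧ b < K
  | .query _ => True

theorem Act.exists_below (α : Act A) : ∃ K, ∀ K', K ≤ K' → α.Below K' := by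
  cases α with
  | assign b a sh => exact ⟨b + a + 1, fun K' h => ⟨by omega, by omega⟩⟩
  | test a b r => exact ⟨b + a + 1, fun K' h => ⟨by omega, by omega⟩⟩
  | query a => exact ⟨0, fun K' _ => trivial⟩

theorem Machine.exists_below (M : Machine A) : ∃ K, 2 ≤ K ∧ ∀ i, (M.act i).Below K := by
  have := M.finLabel
  choose K hK using fun i => (M.act i).exists_below
  obtain ⟨B, hB⟩ := (Set.finite_range K).bddAbove
  exact ⟨B + 2, by omega, fun i => hK i _ ((hB ⟨i, rfl⟩).trans (by omega))⟩

theorem Act.Below.src_le {α : Act A} {K : ℕ} (h : α.Below K) {r : ℕ} (hr : r ≤ K) :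
    α.src r ≤ K := by
  cases α <;> simp only [Act.src, Act.Below] at *
  · split_ifs <;> omega
  · exact hr
  · exact hr

/-- The contents of the registers, where the register `K` is used as a clock. -/
def clocked (K t : ℕ) (s : Store) : Store := update s K t

/-- No action uses the register `K`, so it can be advanced at every step. Each register, the clock
included, is then a copy of one register of the previous row, shifted by 0 or 1. Local rules can
check this for unary marks. -/
theorem Act.Below.clocked_apply {α : Act A} {K : ℕ} (h : α.Below K) (t : ℕ) (s : Store) (r : ℕ) :
    clocked K (t + 1) (α.apply s) r =
      clocked K t s (α.src r) + (decide (r = K) || α.inc r).toNat := by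
  by_cases hr : r = K
  · subst hr
    have : α.src r = r := by
      cases α <;> simp only [Act.src, Act.Below] at *
      rw [if_neg (by omega)]
    simp [clocked, this]
  · have : α.src r ≠ K := by
      cases α <;> simp only [Act.src, Act.Below] at *
      · split_ifs <;> omega
      · exact hr
      · exact hr
    simp [clocked, this, hr, Act.apply]

/-! ### Tableaux of computations -/

/-- The cell with the relative coordinates `i`, `j` in a box with lower left corner `p`. -/
def cell (p : ℤ × ℤ) (i j : ℕ) : ℤ × ℤ := (p.1 + i, p.2 + j)

theorem cell_add (p : ℤ × ℤ) (i j k l : ℕ) :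
    cell p i j + ((k : ℤ), (l : ℤ)) = cell p (i + k) (j + l) := by
  simp only [cell, Prod.mk_add_mk]
  push_cast
  ext <;> simp only <;> ring

theorem cell_east (p : ℤ × ℤ) (i j : ℕ) : cell p i j + (1, 0) = cell p (i + 1) j :=
  cell_add p i j 1 0

theorem cell_north (p : ℤ × ℤ) (i j : ℕ) : cell p i j + (0, 1) = cell p i (j + 1) :=
  cell_add p i j 0 1

theorem cell_northeast (p : ℤ × ℤ) (i j : ℕ) : cell p i j + (1, 1) = cell p (i + 1) (j + 1) :=
  cell_add p i j 1 1

theorem cell_west (p : ℤ × ℤ) (i j : ℕ) : cell p (i + 1) j + (-1, 0) = cell p i j := by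
  rw [← cell_east, add_assoc]; simp

theorem cell_south (p : ℤ × ℤ) (i j : ℕ) : cell p i (j + 1) + (0, -1) = cell p i j := by
  rw [← cell_north, add_assoc]; simp

theorem cell_zero (p : ℤ × ℤ) : cell p 0 0 = p := by simp [cell]

/-- The letters of tableaux: boundary flags, the state and the action of a row, and marks for the
registers whose content is the column. The last register is a clock. -/
structure TileLetter (M : Machine A) (K : ℕ) where
  left : Prop
  right : Prop
  bot : Prop
  top : Prop
  state : M.State
  label : M.Label
  mark : Fin (K + 1) → Prop

/-- Is the register `r` marked? -/
def TileLetter.Marked {M : Machine A} {K : ℕ} (y : TileLetter M K) (r : ℕ) : Prop :=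
  ∃ h : r < K + 1, y.mark ⟨r, h⟩

instance (M : Machine A) (K : ℕ) : Finite (TileLetter M K) := by
  have := M.finState
  have := M.finLabel
  refine Finite.of_injective (fun y : TileLetter M K =>
    (y.left, y.right, y.bot, y.top, y.state, y.label, y.mark)) fun y y' h => ?_
  cases y; cases y'
  simpa using h

/-- The letters by which a search for an error in a tableau is described. -/
structure SearchLetter (A : Type u) where
  path : Prop
  row : Prop
  line : Prop
  col₀ : A → Prop
  col₁ : Prop

instance [Finite A] : Finite (SearchLetter A) := by
  refine Finite.of_injective (fun z : SearchLetter A => (z.path, z.row, z.line, z.col₀, z.col₁))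
    fun z z' h => ?_
  cases z; cases z'
  simpa using h

/-- The local condition for a test. -/
def Act.TestOK {M : Machine A} {K : ℕ} (y : TileLetter M K) : Act A → Prop
  | .assign _ _ _ => True
  | .test a b r => if r then (y.Marked a ↔ y.Marked b) else ¬ (y.Marked a ∧ y.Marked b)
  | .query _ => True

/-- The local conditions for tableaux, except that queries are not checked. -/
structure TileLetter.Good {M : Machine A} {K : ℕ} (y yE yN yNE : TileLetter M K) : Prop where
  bot_east : ¬ y.right → (yE.bot ↔ y.bot)
  top_east : ¬ y.right → (yE.top ↔ y.top)
  left_east : ¬ y.right → ¬ yE.left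
  state_east : ¬ y.right → yE.state = y.state
  label_east : ¬ y.right → yE.label = y.label
  left_north : ¬ y.top → (yN.left ↔ y.left)
  right_north : ¬ y.top → (yN.right ↔ y.right)
  bot_north : ¬ y.top → ¬ yN.bot
  step : ¬ y.top → M.step y.state y.label yN.state
  copy : ¬ y.top → ∀ r ≤ K, (decide (r = K) || (M.act y.label).inc r) = false →
    (yN.Marked r ↔ y.Marked ((M.act y.label).src r))
  -- The mark of an incremented register moves diagonally. The next two conditions treat the
  -- margins: no mark leaves the box on the right and none enters on the left.
  shift : ¬ y.top → ∀ r ≤ K, (decide (r = K) || (M.act y.label).inc r) = true → ¬ y.right →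
    (yNE.Marked r ↔ y.Marked ((M.act y.label).src r))
  shift_right : ¬ y.top → ∀ r ≤ K, (decide (r = K) || (M.act y.label).inc r) = true → y.right →
    ¬ y.Marked ((M.act y.label).src r)
  shift_left : ¬ y.top → ∀ r ≤ K, (decide (r = K) || (M.act y.label).inc r) = true → y.left →
    ¬ yN.Marked r
  test : ¬ y.top → (M.act y.label).TestOK y
  start : y.bot → y.state = M.start
  start_mark : y.bot → ∀ r ≤ K, (y.Marked r ↔ y.left)
  final : y.top → y.state = M.final

/-- The local rules for a search for an error in every box. From the lower left corner, a path has
to lead to a local error or to the row of a query. From that row, lines lead to the cell whose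
letter is queried. -/
structure SearchRule {M : Machine A} {K : ℕ} (a : A) (y yE yN yNE : TileLetter M K)
    (z zE zW zN zS : SearchLetter A) : Prop where
  start : y.left → y.bot → z.path
  -- A path is allowed to go on forever. This is harmless, as in the finite tableau of an accepting
  -- run it is stopped by the right and top borders.
  path : z.path → ¬ y.Good yE yN yNE ∨ (¬ y.right ∧ zE.path) ∨ (¬ y.top ∧ zN.path) ∨ z.row
  row : z.row → ¬ y.top ∧ (y.right ∨ zE.row) ∧ (y.left ∨ zW.row) ∧
    ∃ a', M.act y.label = .query a' ∧ (y.Marked 0 → z.col₀ a') ∧ (y.Marked 1 → z.col₁)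
  col₀ : ∀ a', z.col₀ a' → y.bot ∨ zS.col₀ a'
  -- The clock mark lies in the column whose index is that of the row. Where the column of register
  -- 1 meets it, the height equals the content of register 1, so a horizontal coordinate is turned
  -- into a vertical one.
  col₁ : z.col₁ → (y.bot ∨ zS.col₁) ∧ (y.Marked K → z.line)
  line : z.line → (y.right ∨ zE.line) ∧ (y.left ∨ zW.line)
  mismatch : z.line → ∀ a', z.col₀ a' → a ≠ a'

/-- The tableau `Y` satisfies its local conditions at `c`. -/
def GoodAt {M : Machine A} {K : ℕ} (Y : Config (TileLetter M K)) (c : ℤ × ℤ) : Prop :=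
  (Y c).Good (Y (c + (1, 0))) (Y (c + (0, 1))) (Y (c + (1, 1)))

/-- The search `Z` satisfies its rules at `c`. -/
def RuleAt {M : Machine A} {K : ℕ} (x : Config A) (Y : Config (TileLetter M K))
    (Z : Config (SearchLetter A)) (c : ℤ × ℤ) : Prop :=
  SearchRule (x c) (Y c) (Y (c + (1, 0))) (Y (c + (0, 1))) (Y (c + (1, 1)))
    (Z c) (Z (c + (1, 0))) (Z (c + (-1, 0))) (Z (c + (0, 1))) (Z (c + (0, -1)))

/-! ### The tableau of an accepting run has no error -/

theorem exists_seq_of_reflTransGen {α : Type*} {R : α → α → Prop} {a b : α}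
    (h : ReflTransGen R a b) : ∃ (n : ℕ) (c : ℕ → α), c 0 = a ∧ c n = b ∧
      ∀ t < n, R (c t) (c (t + 1)) := by
  induction h using ReflTransGen.head_induction_on with
  | refl => exact ⟨0, fun _ => b, rfl, rfl, by simp⟩
  | @head a a' hst _ ih =>
    obtain ⟨n, c, h0, hn, hc⟩ := ih
    refine ⟨n + 1, fun t => Nat.casesOn t a c, rfl, hn, fun t ht => ?_⟩
    cases t with
    | zero => simpa [h0] using hst
    | succ t => exact hc t (by omega)

theorem forall_le_of_spread {P : ℕ → Prop} {n k : ℕ} (hk : k ≤ n) (h : P k)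
    (up : ∀ i < n, P i → P (i + 1)) (down : ∀ i < n, P (i + 1) → P i) : ∀ i ≤ n, P i := by
  have h1 : ∀ i ≤ n, k ≤ i → P i := by
    intro i hi hki
    induction i, hki using Nat.le_induction with
    | base => exact h
    | succ i _ ih => exact up i hi (ih (by omega))
  have h0 : ∀ d i, i + d ≤ n → P (i + d) → P i := by
    intro d
    induction d with
    | zero => exact fun i _ h => h
    | succ d ih => exact fun i hi h => ih i (by omega) (down _ (by omega) h)
  intro i hi
  rcases le_total k i with hki | hki
  · exact h1 i hi hki
  · obtain ⟨d, rfl⟩ := Nat.exists_eq_add_of_le hki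
    exact h0 d i hk h

/-- Registers grow by at most one per step, so a run of length `n` fits into a box with sides `n +
1`. No rule of `Good` is violated in it, so a search obeying its rules would have to mark a query
row; the lines drawn from there meet at the queried cell, whose letter is the expected one. -/
theorem exists_tableau_of_accepts {M : Machine A} [Nonempty M.Label] {K : ℕ} (hK : 2 ≤ K)
    (hbelow : ∀ i, (M.act i).Below K) (x : Config A) (p : ℤ × ℤ)
    (h : M.Accepts fun i j => x (cell p i j)) :
    ∃ Y : Config (TileLetter M K), ∀ Z, ∃ c, ¬ RuleAt x Y Z c := by
  obtain ⟨s₁, h⟩ := h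
  obtain ⟨n, d, hd0, hdn, hd⟩ := exists_seq_of_reflTransGen h
  have hex : ∃ α : ℕ → M.Label, ∀ t < n, M.step (d t).1 (α t) (d (t + 1)).1 ∧
      (M.act (α t)).rel (fun i j => x (cell p i j)) (d t).2 (d (t + 1)).2 := by
    choose α hα using hd
    -- Rows from `n` on perform no action, but still need some label.
    exact ⟨fun t => if ht : t < n then α t ht else Classical.arbitrary _, fun t ht => by
      simpa [ht] using hα t ht⟩
  obtain ⟨α, hα⟩ := hex
  simp only [Act.rel_iff] at hα
  let S : ℕ → Store := fun t => clocked K t (d t).2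
  have hS0 : ∀ r, S 0 r = 0 := by
    intro r
    simp only [S, clocked, hd0]
    by_cases hr : r = K
    · subst hr; simp
    · simp [hr]
  have hSs : ∀ t < n, ∀ r, S (t + 1) r = S t ((M.act (α t)).src r) +
      (decide (r = K) || (M.act (α t)).inc r).toNat := by
    intro t ht r
    simp only [S]
    rw [(hα t ht).2.1, (hbelow _).clocked_apply]
  have hSle : ∀ t ≤ n, ∀ r, S t r ≤ t := by
    intro t
    induction t with
    | zero => intro _ r; rw [hS0]
    | succ t ih =>
      intro ht r
      rw [hSs t (by omega)]
      have := ih (by omega) ((M.act (α t)).src r)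
      have := Bool.toNat_le (decide (r = K) || (M.act (α t)).inc r)
      omega
  have hSK : ∀ t, S t K = t := fun t => by simp [S, clocked]
  have hSr : ∀ t r, r ≠ K → S t r = (d t).2 r := fun t r hr => by simp [S, clocked, hr]
  let Y : Config (TileLetter M K) := fun c =>
    { left := c.1 = p.1
      right := c.1 = p.1 + n
      bot := c.2 = p.2
      top := c.2 = p.2 + n
      state := (d (c.2 - p.2).toNat).1
      label := α (c.2 - p.2).toNat
      mark := fun r => c.1 = p.1 + S (c.2 - p.2).toNat r }
  have yl : ∀ i j, (Y (cell p i j)).left ↔ i = 0 := by intro i j; simp [Y, cell]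
  have yr : ∀ i j, (Y (cell p i j)).right ↔ i = n := by intro i j; simp [Y, cell]
  have yb : ∀ i j, (Y (cell p i j)).bot ↔ j = 0 := by intro i j; simp [Y, cell]
  have yt : ∀ i j, (Y (cell p i j)).top ↔ j = n := by intro i j; simp [Y, cell]
  have ys : ∀ i j, (Y (cell p i j)).state = (d j).1 := by intro i j; simp [Y, cell]
  have ylab : ∀ i j, (Y (cell p i j)).label = α j := by intro i j; simp [Y, cell]
  have ym : ∀ i j r, r ≤ K → ((Y (cell p i j)).Marked r ↔ i = S j r) := by
    intro i j r hr
    simp only [TileLetter.Marked, Y, cell, add_sub_cancel_left, Int.toNat_natCast,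
      add_right_inj, Nat.cast_inj, exists_prop, and_iff_right_iff_imp]
    omega
  have good : ∀ i j, i ≤ n → j ≤ n → GoodAt Y (cell p i j) := by
    intro i j hi hj
    simp only [GoodAt, cell_east, cell_north, cell_northeast]
    constructor <;> simp only [yl, yr, yb, yt, ys, ylab]
    · simp
    · simp
    · omega
    · simp
    · simp
    · simp
    · simp
    · omega
    · intro h
      exact (hα j (by omega)).1
    · intro h r hr hinc
      rw [ym _ _ _ hr, ym _ _ _ ((hbelow _).src_le hr), hSs j (by omega), hinc]
      simp
    · intro h r hr hinc _
      rw [ym _ _ _ hr, ym _ _ _ ((hbelow _).src_le hr), hSs j (by omega), hinc]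
      simp
    · rintro h r hr hinc rfl
      rw [ym _ _ _ ((hbelow _).src_le hr)]
      have := hSle j hj ((M.act (α j)).src r)
      omega
    · rintro h r hr hinc rfl
      rw [ym _ _ _ hr, hSs j (by omega), hinc]
      simp
    · intro h
      have hg := (hα j (by omega)).2.2
      have hb := hbelow (α j)
      cases hact : M.act (α j) with
      | assign => trivial
      | query => trivial
      | test a b r =>
        rw [hact] at hg hb
        simp only [Act.Guard] at hg
        obtain ⟨ha, hb⟩ := hb
        rw [← hSr j a ha.ne, ← hSr j b hb.ne] at hg
        cases r with
        | true =>
          simp only [Act.TestOK, if_true, ym _ _ _ ha.le, ym _ _ _ hb.le]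
          simp only [iff_true] at hg
          rw [hg]
        | false =>
          simp only [Act.TestOK, Bool.false_eq_true, if_false, ym _ _ _ ha.le, ym _ _ _ hb.le]
          simp only [Bool.false_eq_true, iff_false] at hg
          rintro ⟨h1, h2⟩
          exact hg (h1.symm.trans h2)
    · rintro rfl
      rw [hd0]
    · rintro rfl r hr
      rw [ym _ _ _ hr, hS0]
    · rintro rfl
      rw [hdn]
  refine ⟨Y, fun Z => ?_⟩
  by_contra! hZ
  have rule : ∀ i j, SearchRule (x (cell p i j)) (Y (cell p i j)) (Y (cell p (i + 1) j))
      (Y (cell p i (j + 1))) (Y (cell p (i + 1) (j + 1))) (Z (cell p i j))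
      (Z (cell p (i + 1) j)) (Z (cell p i j + (-1, 0))) (Z (cell p i (j + 1)))
      (Z (cell p i j + (0, -1))) := by
    intro i j
    simpa only [RuleAt, cell_east, cell_north, cell_northeast] using hZ (cell p i j)
  have norow : ∀ i j, i ≤ n → j ≤ n → ¬ (Z (cell p i j)).row := by
    intro i j hi hj hrow
    have hjn : j < n := by
      have := ((rule i j).row hrow).1
      rw [yt] at this
      omega
    have hrows : ∀ i ≤ n, (Z (cell p i j)).row := by
      refine forall_le_of_spread hi hrow (fun i hi h => ?_) fun i hi h => ?_
      · have := ((rule i j).row h).2.1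
        rw [yr] at this
        exact this.resolve_left (by omega)
      · have := ((rule (i + 1) j).row h).2.2.1
        rw [yl, cell_west] at this
        exact this.resolve_left (by omega)
    have h0 := hSle j hj 0
    have h1 := hSle j hj 1
    obtain ⟨a, ha, hc0, -⟩ := ((rule (S j 0) j).row (hrows _ (by omega))).2.2.2
    obtain ⟨-, -, -, hc1⟩ := ((rule (S j 1) j).row (hrows _ (by omega))).2.2.2
    replace hc0 := hc0 ((ym _ _ _ (by omega)).2 rfl)
    replace hc1 := hc1 ((ym _ _ _ (by omega)).2 rfl)
    rw [ylab] at ha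
    have hx : x (cell p (S j 0) (S j 1)) = a := by
      have := (hα j hjn).2.2
      rw [ha] at this
      simpa only [Act.Guard, ← hSr j 0 (by omega), ← hSr j 1 (by omega)] using this
    -- Both vertical lines run downwards from the query row `j`; the queried height `S j 1` is at
    -- most `j` because registers never exceed the time.
    have hcol0 : ∀ j' ≤ j, (Z (cell p (S j 0) j')).col₀ a := by
      intro j' hj'
      induction hj' using Nat.decreasingInduction with
      | self => exact hc0
      | of_succ k hk ih =>
        have := (rule _ _).col₀ a ih
        rw [yb, cell_south] at this
        exact this.resolve_left (by omega)
    have hcol1 : ∀ j' ≤ j, (Z (cell p (S j 1) j')).col₁ := by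
      intro j' hj'
      induction hj' using Nat.decreasingInduction with
      | self => exact hc1
      | of_succ k hk ih =>
        have := ((rule _ _).col₁ ih).1
        rw [yb, cell_south] at this
        exact this.resolve_left (by omega)
    have hline : (Z (cell p (S j 1) (S j 1))).line :=
      ((rule _ _).col₁ (hcol1 _ h1)).2 ((ym _ _ _ le_rfl).2 (hSK _).symm)
    have hlines : ∀ i ≤ n, (Z (cell p i (S j 1))).line := by
      refine forall_le_of_spread (by omega) hline (fun i hi h => ?_) fun i hi h => ?_
      · have := ((rule i _).line h).1
        rw [yr] at this
        exact this.resolve_left (by omega)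
      · have := ((rule (i + 1) _).line h).2
        rw [yl, cell_west] at this
        exact this.resolve_left (by omega)
    exact (rule _ _).mismatch (hlines _ (by omega)) a (hcol0 _ h1) hx
  -- Strong induction on the distance `k` to the upper right corner.
  have nopath : ∀ k i j, i ≤ n → j ≤ n → n - i + (n - j) = k → ¬ (Z (cell p i j)).path := by
    intro k
    induction k using Nat.strong_induction_on with
    | _ k ih =>
      intro i j hi hj hk hp
      have hgood := good i j hi hj
      simp only [GoodAt, cell_east, cell_north, cell_northeast] at hgood
      rcases (rule i j).path hp with h | ⟨h, h'⟩ | ⟨h, h'⟩ | h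
      · exact h hgood
      · rw [yr] at h
        exact ih (n - (i + 1) + (n - j)) (by omega) (i + 1) j (by omega) hj rfl h'
      · rw [yt] at h
        exact ih (n - i + (n - (j + 1))) (by omega) i (j + 1) hi (by omega) rfl h'
      · exact norow i j hi hj h
  exact nopath _ 0 0 (Nat.zero_le _) (Nat.zero_le _) rfl
    ((rule 0 0).start ((yl 0 0).2 rfl) ((yb 0 0).2 rfl))

/-! ### If no run is accepting, every tableau has an error -/

/-- A cell from which no path leads to an error or to a cell of `H`, and that is not the start of
an infinite path. -/
inductive Closed {M : Machine A} {K : ℕ} (Y : Config (TileLetter M K)) (H : ℤ × ℤ → Prop) :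
    ℤ × ℤ → Prop
  | mk (c : ℤ × ℤ) (good : GoodAt Y c) (not : ¬ H c)
    (east : ¬ (Y c).right → Closed Y H (c + (1, 0)))
    (north : ¬ (Y c).top → Closed Y H (c + (0, 1))) : Closed Y H c

/-- An error-free box with lower left corner `p`. -/
structure Box {M : Machine A} {K : ℕ} (Y : Config (TileLetter M K)) (p : ℤ × ℤ) (w h : ℕ) :
    Prop where
  left : ∀ i ≤ w, ∀ j ≤ h, ((Y (cell p i j)).left ↔ i = 0)
  right : ∀ i ≤ w, ∀ j ≤ h, ((Y (cell p i j)).right ↔ i = w)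
  bot : ∀ i ≤ w, ∀ j ≤ h, ((Y (cell p i j)).bot ↔ j = 0)
  top : ∀ i ≤ w, ∀ j ≤ h, ((Y (cell p i j)).top ↔ j = h)
  good : ∀ i ≤ w, ∀ j ≤ h, (Y (cell p i j)).Good (Y (cell p (i + 1) j)) (Y (cell p i (j + 1)))
    (Y (cell p (i + 1) (j + 1)))

variable {M : Machine A} {K : ℕ} {Y : Config (TileLetter M K)} {H : ℤ × ℤ → Prop}

/-- `Closed` is inductive, so the walk to the east cannot be infinite and must end at a right
border. This is what makes boxes finite. -/
theorem Closed.exists_right {c : ℤ × ℤ} (h : Closed Y H c) : ∃ w, (Y (cell c w 0)).right := by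
  induction h with
  | mk c _ _ _ _ east _ =>
    by_cases hr : (Y c).right
    · exact ⟨0, by rwa [cell_zero]⟩
    · obtain ⟨w, hw⟩ := east hr
      refine ⟨w + 1, ?_⟩
      rwa [show cell c (w + 1) 0 = cell (c + (1, 0)) w 0 by
        simp [cell]; ring]

theorem Closed.exists_top {c : ℤ × ℤ} (h : Closed Y H c) : ∃ w, (Y (cell c 0 w)).top := by
  induction h with
  | mk c _ _ _ _ _ north =>
    by_cases hr : (Y c).top
    · exact ⟨0, by rwa [cell_zero]⟩
    · obtain ⟨w, hw⟩ := north hr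
      refine ⟨w + 1, ?_⟩
      rwa [show cell c 0 (w + 1) = cell (c + (0, 1)) 0 w by
        simp [cell]; ring]

theorem Closed.goodAt {c : ℤ × ℤ} (h : Closed Y H c) : GoodAt Y c := by
  cases h; assumption

theorem Closed.east {c : ℤ × ℤ} (h : Closed Y H c) (hr : ¬ (Y c).right) :
    Closed Y H (c + (1, 0)) := by
  cases h with | mk _ _ _ east _ => exact east hr

theorem Closed.north {c : ℤ × ℤ} (h : Closed Y H c) (hr : ¬ (Y c).top) :
    Closed Y H (c + (0, 1)) := by
  cases h with | mk _ _ _ _ north => exact north hr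

theorem Closed.not_mem {c : ℤ × ℤ} (h : Closed Y H c) : ¬ H c := by
  cases h; assumption

theorem Closed.good {p : ℤ × ℤ} {i j : ℕ} (h : Closed Y H (cell p i j)) :
    (Y (cell p i j)).Good (Y (cell p (i + 1) j)) (Y (cell p i (j + 1)))
      (Y (cell p (i + 1) (j + 1))) := by
  simpa only [GoodAt, cell_east, cell_north, cell_northeast] using h.goodAt

/-- The first right and top flags met from the corner give the size. The local conditions carry the
border flags from cell to cell, and every cell reached is again closed, hence free of errors. -/
theorem Closed.exists_box {p : ℤ × ℤ} (hc : Closed Y H p) (hleft : (Y p).left)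
    (hbot : (Y p).bot) : ∃ w h, Box Y p w h ∧ ∀ i ≤ w, ∀ j ≤ h, Closed Y H (cell p i j) := by
  classical
  have hexw := hc.exists_right
  have hexh := hc.exists_top
  let w := Nat.find hexw
  let h := Nat.find hexh
  have hw : (Y (cell p w 0)).right := Nat.find_spec hexw
  have hh : (Y (cell p 0 h)).top := Nat.find_spec hexh
  have hw' : ∀ i < w, ¬ (Y (cell p i 0)).right := fun i hi => Nat.find_min hexw hi
  have hh' : ∀ j < h, ¬ (Y (cell p 0 j)).top := fun j hj => Nat.find_min hexh hj
  have row0 : ∀ i ≤ w, Closed Y H (cell p i 0) ∧ ((Y (cell p i 0)).left ↔ i = 0) ∧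
      (Y (cell p i 0)).bot ∧ ((Y (cell p i 0)).right ↔ i = w) := by
    intro i hi
    refine and_assoc.1 (and_assoc.1 ⟨?_, ?_⟩)
    · induction i with
      | zero => rw [cell_zero]; exact ⟨⟨hc, by simpa using hleft⟩, hbot⟩
      | succ i ih =>
        obtain ⟨⟨h1, h2⟩, h3⟩ := ih (by omega)
        have hr := hw' i (by omega)
        refine ⟨⟨?_, ?_⟩, (h1.good.bot_east hr).2 h3⟩
        · rw [← cell_east]; exact h1.east hr
        · simpa using h1.good.left_east hr
    · rcases hi.lt_or_eq with hi | rfl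
      · simpa [hi.ne] using hw' i hi
      · simpa using hw
  have all : ∀ j ≤ h, ∀ i ≤ w, Closed Y H (cell p i j) ∧ ((Y (cell p i j)).left ↔ i = 0) ∧
      ((Y (cell p i j)).bot ↔ j = 0) ∧ ((Y (cell p i j)).right ↔ i = w) ∧
      ((Y (cell p i j)).top ↔ j = h) := by
    intro j
    induction j with
    | zero =>
      intro hj i hi
      obtain ⟨h1, h2, h3, h4⟩ := row0 i hi
      refine ⟨h1, h2, by simpa using h3, h4, ?_⟩
      have : ∀ i ≤ w, ((Y (cell p i 0)).top ↔ 0 = h) := by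
        intro i
        induction i with
        | zero =>
          intro _
          rcases hj.lt_or_eq with hj | hj
          · simpa [hj.ne] using hh' 0 hj
          · rw [iff_true_right hj]; rw [← hj] at hh; exact hh
        | succ i ih =>
          intro hi
          rw [(row0 i (by omega)).1.good.top_east (hw' i (by omega)), ih (by omega)]
      exact this i hi
    | succ j ih =>
      intro hj
      have hnt : ∀ i ≤ w, ¬ (Y (cell p i j)).top := by
        intro i hi
        rw [(ih (by omega) i hi).2.2.2.2]
        omega
      have hcl : ∀ i ≤ w, Closed Y H (cell p i (j + 1)) := by
        intro i hi
        rw [← cell_north]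
        exact (ih (by omega) i hi).1.north (hnt i hi)
      have hri : ∀ i ≤ w, ((Y (cell p i (j + 1))).right ↔ i = w) := by
        intro i hi
        rw [(ih (by omega) i hi).1.good.right_north (hnt i hi), (ih (by omega) i hi).2.2.2.1]
      have htop : ∀ i ≤ w, ((Y (cell p i (j + 1))).top ↔ j + 1 = h) := by
        intro i
        induction i with
        | zero =>
          intro _
          rcases hj.lt_or_eq with hj | hj
          · simpa [hj.ne] using hh' _ hj
          · rw [iff_true_right hj]; rw [← hj] at hh; exact hh
        | succ i ihi =>
          intro hi
          rw [(hcl i (by omega)).good.top_east (by rw [hri i (by omega)]; omega), ihi (by omega)]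
      intro i hi
      refine ⟨hcl i hi, ?_, ?_, hri i hi, htop i hi⟩
      · rw [(ih (by omega) i hi).1.good.left_north (hnt i hi), (ih (by omega) i hi).2.1]
      · simpa using (ih (by omega) i hi).1.good.bot_north (hnt i hi)
  exact ⟨w, h, ⟨fun i hi j hj => (all j hj i hi).2.1, fun i hi j hj => (all j hj i hi).2.2.2.1,
    fun i hi j hj => (all j hj i hi).2.2.1, fun i hi j hj => (all j hj i hi).2.2.2.2,
    fun i hi j hj => (all j hj i hi).1.good⟩, fun i hi j hj => (all j hj i hi).1⟩

/-- Different error-free boxes are disjoint. -/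
theorem Box.eq_of_cell_eq {p p' : ℤ × ℤ} {w h w' h' i j i' j' : ℕ} (hb : Box Y p w h)
    (hb' : Box Y p' w' h') (hi : i ≤ w) (hj : j ≤ h) (hi' : i' ≤ w') (hj' : j' ≤ h')
    (heq : cell p i j = cell p' i' j') : p = p' ∧ i = i' ∧ j = j' := by
  have e1 : p.1 + i = p'.1 + i' := congrArg Prod.fst heq
  have e2 : p.2 + j = p'.2 + j' := congrArg Prod.snd heq
  have hii : i = i' := by
    rcases le_total i i' with hle | hle
    · have hc : cell p 0 j = cell p' (i' - i) j' := by
        simp only [cell, Prod.mk.injEq]; omega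
      have := (hb.left 0 (by omega) j hj).2 rfl
      rw [hc, hb'.left (i' - i) (by omega) j' hj'] at this
      omega
    · have hc : cell p' 0 j' = cell p (i - i') j := by
        simp only [cell, Prod.mk.injEq]; omega
      have := (hb'.left 0 (by omega) j' hj').2 rfl
      rw [hc, hb.left (i - i') (by omega) j hj] at this
      omega
  have hjj : j = j' := by
    rcases le_total j j' with hle | hle
    · have hc : cell p i 0 = cell p' i' (j' - j) := by
        simp only [cell, Prod.mk.injEq]; omega
      have := (hb.bot i hi 0 (by omega)).2 rfl
      rw [hc, hb'.bot i' hi' (j' - j) (by omega)] at this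
      omega
    · have hc : cell p' i' 0 = cell p i (j - j') := by
        simp only [cell, Prod.mk.injEq]; omega
      have := (hb'.bot i' hi' 0 (by omega)).2 rfl
      rw [hc, hb.bot i hi (j - j') (by omega)] at this
      omega
  subst hii hjj
  exact ⟨Prod.ext (by omega) (by omega), rfl, rfl⟩

/-- In the row `t` of a box, the letter `a` is queried at the cell with the relative coordinates
`i`, `j`, but `x` has a different letter there. -/
structure Mismatch (x : Config A) (Y : Config (TileLetter M K)) (p : ℤ × ℤ)
    (w h t i j : ℕ) (a : A) : Prop where
  box : Box Y p w h
  lt : t < h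
  i_le : i ≤ w
  j_le : j ≤ t
  j_le' : j ≤ w
  act : ∀ k ≤ w, M.act (Y (cell p k t)).label = .query a
  mark₀ : ∀ k ≤ w, (Y (cell p k t)).Marked 0 → k = i
  mark₁ : ∀ k ≤ w, (Y (cell p k t)).Marked 1 → k = j
  clock : ∀ l ≤ t, (Y (cell p j l)).Marked K → j = l
  ne : x (cell p i j) ≠ a

/-- The labels of the first column determine a sequence of stores `s`, and the local conditions
force the marks to agree with it. Since this is not an accepting run, some guard fails; tests are
checked locally, so it is the guard of a query. -/
theorem Box.exists_mismatch (hK : 2 ≤ K) (hbelow : ∀ i, (M.act i).Below K) {x : Config A}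
    {p : ℤ × ℤ} {w h : ℕ} (hb : Box Y p w h) (hx : ¬ M.Accepts fun i j => x (cell p i j)) :
    ∃ t i j a, Mismatch x Y p w h t i j a := by
  let α : ℕ → M.Label := fun t => (Y (cell p 0 t)).label
  let q : ℕ → M.State := fun t => (Y (cell p 0 t)).state
  let s : ℕ → Store := fun t => Nat.rec (fun _ => 0) (fun t s => (M.act (α t)).apply s) t
  let S : ℕ → Store := fun t => clocked K t (s t)
  have hs : ∀ t, s (t + 1) = (M.act (α t)).apply (s t) := fun t => rfl
  have hS0 : ∀ r, S 0 r = 0 := by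
    intro r
    by_cases hr : r = K
    · subst hr; simp [S, clocked]
    · simp [S, clocked, hr, s]
  have hSs : ∀ t r, S (t + 1) r = S t ((M.act (α t)).src r) +
      (decide (r = K) || (M.act (α t)).inc r).toNat := by
    intro t r
    simp only [S]
    rw [hs, (hbelow _).clocked_apply]
  have hSle : ∀ t r, S t r ≤ t := by
    intro t
    induction t with
    | zero => intro r; rw [hS0]
    | succ t ih =>
      intro r
      rw [hSs t]
      have := ih ((M.act (α t)).src r)
      have := Bool.toNat_le (decide (r = K) || (M.act (α t)).inc r)
      omega
  have hSK : ∀ t, S t K = t := fun t => by simp [S, clocked]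
  have hSr : ∀ t r, r ≠ K → S t r = s t r := fun t r hr => by simp [S, clocked, hr]
  have nr : ∀ i < w, ∀ t ≤ h, ¬ (Y (cell p i t)).right := by
    intro i hi t ht
    rw [hb.right i hi.le t ht]
    omega
  have nt : ∀ i ≤ w, ∀ t < h, ¬ (Y (cell p i t)).top := by
    intro i hi t ht
    rw [hb.top i hi t ht.le]
    omega
  have lab : ∀ t ≤ h, ∀ i ≤ w, (Y (cell p i t)).label = α t := by
    intro t ht i
    induction i with
    | zero => exact fun _ => rfl
    | succ i ih =>
      intro hi
      rw [(hb.good i (by omega) t ht).label_east (nr i (by omega) t ht), ih (by omega)]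
  -- That the contents stay within the width is part of the induction: `shift_right` forbids
  -- incrementing a register at the right border.
  have mark : ∀ t ≤ h, ∀ r ≤ K, S t r ≤ w ∧ ∀ i ≤ w, ((Y (cell p i t)).Marked r ↔ i = S t r) := by
    intro t
    induction t with
    | zero =>
      intro ht r hr
      rw [hS0]
      refine ⟨Nat.zero_le _, fun i hi => ?_⟩
      rw [(hb.good i hi 0 ht).start_mark ((hb.bot i hi 0 ht).2 rfl) r hr, hb.left i hi 0 ht]
    | succ t ih =>
      intro ht r hr
      have hsrc := (hbelow (α t)).src_le hr
      obtain ⟨h1, h2⟩ := ih (by omega) _ hsrc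
      rw [hSs]
      cases hinc : (decide (r = K) || (M.act (α t)).inc r) with
      | false =>
        refine ⟨by simpa using h1, fun i hi => ?_⟩
        have := (hb.good i hi t (by omega)).copy (nt i hi t (by omega)) r hr
        rw [lab t (by omega) i hi] at this
        rw [this hinc, h2 i hi]
        simp
      | true =>
        have hlt : S t ((M.act (α t)).src r) < w := by
          refine lt_of_le_of_ne h1 fun he => ?_
          have := (hb.good w le_rfl t (by omega)).shift_right (nt w le_rfl t (by omega)) r hr
          rw [lab t (by omega) w le_rfl] at this
          exact this hinc ((hb.right w le_rfl t (by omega)).2 rfl) ((h2 w le_rfl).2 he.symm)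
        refine ⟨hlt, fun i hi => ?_⟩
        cases i with
        | zero =>
          have := (hb.good 0 hi t (by omega)).shift_left (nt 0 hi t (by omega)) r hr
          rw [lab t (by omega) 0 hi] at this
          refine iff_of_false (this hinc ((hb.left 0 hi t (by omega)).2 rfl)) ?_
          simp
        | succ i =>
          have := (hb.good i (by omega) t (by omega)).shift (nt i (by omega) t (by omega)) r hr
          rw [lab t (by omega) i (by omega)] at this
          rw [this hinc (nr i (by omega) t (by omega)), h2 i (by omega)]
          simp
  have hex : ∃ t < h, ¬ (M.act (α t)).Guard (fun i j => x (cell p i j)) (s t) := by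
    by_contra! hall
    apply hx
    have run : ∀ t ≤ h, ReflTransGen (M.Next fun i j => x (cell p i j))
        (M.start, fun _ => 0) (q t, s t) := by
      intro t
      induction t with
      | zero =>
        intro h0
        have : q 0 = M.start :=
          (hb.good 0 (Nat.zero_le _) 0 h0).start ((hb.bot 0 (Nat.zero_le _) 0 h0).2 rfl)
        rw [this]
        exact .refl
      | succ t ih =>
        intro ht
        refine (ih (by omega)).tail ⟨α t, (hb.good 0 (Nat.zero_le _) t (by omega)).step
          (nt 0 (Nat.zero_le _) t (by omega)), ?_⟩
        rw [Act.rel_iff]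
        exact ⟨hs t, hall t (by omega)⟩
    have hfin : q h = M.final :=
      (hb.good 0 (Nat.zero_le _) h le_rfl).final ((hb.top 0 (Nat.zero_le _) h le_rfl).2 rfl)
    exact ⟨s h, hfin ▸ run h le_rfl⟩
  obtain ⟨t, ht, hg⟩ := hex
  have hbt := hbelow (α t)
  have htest : ∀ i ≤ w, (M.act (α t)).TestOK (Y (cell p i t)) := by
    intro i hi
    have := (hb.good i hi t ht.le).test (nt i hi t ht)
    rwa [lab t ht.le i hi] at this
  cases hact : M.act (α t) with
  | assign b a sh => rw [hact] at hg; exact absurd trivial hg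
  | test a b r =>
    rw [hact] at hg hbt htest
    obtain ⟨ha, hb'⟩ := hbt
    obtain ⟨ma, ma'⟩ := mark t ht.le a ha.le
    obtain ⟨mb, mb'⟩ := mark t ht.le b hb'.le
    have htest' := htest _ ma
    simp only [Act.TestOK, ma' _ ma, mb' _ ma] at htest'
    simp only [Act.Guard, ← hSr t a ha.ne, ← hSr t b hb'.ne] at hg
    cases r <;> simp_all
  | query a =>
    rw [hact] at hg
    simp only [Act.Guard, ← hSr t 0 (by omega), ← hSr t 1 (by omega)] at hg
    obtain ⟨m0, m0'⟩ := mark t ht.le 0 (by omega)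
    obtain ⟨m1, m1'⟩ := mark t ht.le 1 (by omega)
    refine ⟨t, S t 0, S t 1, a, hb, ht, m0, hSle t 1, m1, fun k hk => ?_,
      fun k hk => (m0' k hk).1, fun k hk => (m1' k hk).1, fun l hl hm => ?_, hg⟩
    · rw [lab t ht.le k hk, hact]
    · rw [((mark l (by omega) K le_rfl).2 _ m1).1 hm, hSK]

/-- One wrong query is chosen in every error-free box, and its row and lines are drawn. Paths are
marked wherever `Closed` fails, so the path rule is the negation of the constructor of `Closed`. A
closed corner would span a box containing its own query row, which is excluded. -/
theorem exists_search_of_not_accepts (hK : 2 ≤ K) (hbelow : ∀ i, (M.act i).Below K)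
    (x : Config A) (hx : ∀ p, ¬ M.Accepts fun i j => x (cell p i j))
    (Y : Config (TileLetter M K)) : ∃ Z, ∀ c, RuleAt x Y Z c := by
  have hex : ∀ p : {p // ∃ w h, Box Y p w h}, ∃ w h t i j a, Mismatch x Y p.1 w h t i j a := by
    rintro ⟨p, w, h, hb⟩
    obtain ⟨t, i, j, a, hm⟩ := hb.exists_mismatch hK hbelow (hx p)
    exact ⟨w, h, t, i, j, a, hm⟩
  choose w h t i j a hm using hex
  let row : ℤ × ℤ → Prop := fun c => ∃ p, ∃ k ≤ w p, c = cell p.1 k (t p)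
  let Z : Config (SearchLetter A) := fun c =>
    { path := ¬ Closed Y row c
      row := row c
      line := ∃ p, ∃ k ≤ w p, c = cell p.1 k (j p)
      col₀ := fun a' => ∃ p, a' = a p ∧ ∃ l ≤ t p, c = cell p.1 (i p) l
      col₁ := ∃ p, ∃ l ≤ t p, c = cell p.1 (j p) l }
  refine ⟨Z, fun c => ⟨?_, ?_, ?_, ?_, ?_, ?_, ?_⟩⟩
  · intro hl hb hc
    obtain ⟨w', h', hbox, hcl⟩ := hc.exists_box hl hb
    let p : {p // ∃ w h, Box Y p w h} := ⟨c, w', h', hbox⟩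
    -- The right and top flags determine the size of a box with a given corner, so the chosen box is
    -- the one just found.
    obtain ⟨e1, e2⟩ : w' = w p ∧ h' = h p := by
      have hb2 := (hm p).box
      constructor
      · rcases le_total w' (w p) with hle | hle
        · have := (hbox.right w' le_rfl 0 (Nat.zero_le _)).2 rfl
          exact (hb2.right w' hle 0 (Nat.zero_le _)).1 this
        · have := (hb2.right (w p) le_rfl 0 (Nat.zero_le _)).2 rfl
          exact ((hbox.right (w p) hle 0 (Nat.zero_le _)).1 this).symm
      · rcases le_total h' (h p) with hle | hle
        · have := (hbox.top 0 (Nat.zero_le _) h' le_rfl).2 rfl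
          exact (hb2.top 0 (Nat.zero_le _) h' hle).1 this
        · have := (hb2.top 0 (Nat.zero_le _) (h p) le_rfl).2 rfl
          exact ((hbox.top 0 (Nat.zero_le _) (h p) hle).1 this).symm
    have := (hm p).lt
    exact (hcl 0 (Nat.zero_le _) (t p) (by omega)).not_mem ⟨p, 0, Nat.zero_le _, rfl⟩
  · intro hp
    by_contra! hcon
    obtain ⟨h1, h2, h3, h4⟩ := hcon
    exact hp ⟨c, h1, h4, fun hr => not_not.1 (h2 hr), fun ht => not_not.1 (h3 ht)⟩
  · rintro ⟨p, k, hk, rfl⟩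
    have hb := (hm p).box
    have ht := (hm p).lt
    refine ⟨?_, ?_, ?_, a p, (hm p).act k hk, fun h0 => ?_, fun h1 => ?_⟩
    · rw [hb.top k hk _ ht.le]; omega
    · rw [hb.right k hk _ ht.le, cell_east, or_iff_not_imp_left]
      exact fun hne => ⟨p, k + 1, by omega, rfl⟩
    · rw [hb.left k hk _ ht.le]
      cases k with
      | zero => exact .inl rfl
      | succ k =>
        rw [cell_west]
        exact .inr ⟨p, k, by omega, rfl⟩
    · exact ⟨p, rfl, t p, le_rfl, by rw [(hm p).mark₀ k hk h0]⟩
    · exact ⟨p, t p, le_rfl, by rw [(hm p).mark₁ k hk h1]⟩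
  · rintro a' ⟨p, rfl, l, hl, rfl⟩
    have hb := (hm p).box
    have ht := (hm p).lt
    rw [hb.bot _ (hm p).i_le _ (by omega)]
    cases l with
    | zero => exact .inl rfl
    | succ l =>
      rw [cell_south]
      exact .inr ⟨p, rfl, l, by omega, rfl⟩
  · rintro ⟨p, l, hl, rfl⟩
    have hb := (hm p).box
    have ht := (hm p).lt
    refine ⟨?_, fun hK' => ⟨p, j p, (hm p).j_le', by rw [← (hm p).clock l hl hK']⟩⟩
    rw [hb.bot _ (hm p).j_le' _ (by omega)]
    cases l with
    | zero => exact .inl rfl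
    | succ l =>
      rw [cell_south]
      exact .inr ⟨p, l, by omega, rfl⟩
  · rintro ⟨p, k, hk, rfl⟩
    have hb := (hm p).box
    have ht := (hm p).lt
    have hj := (hm p).j_le
    refine ⟨?_, ?_⟩
    · rw [hb.right k hk _ (by omega), cell_east, or_iff_not_imp_left]
      exact fun hne => ⟨p, k + 1, by omega, rfl⟩
    · rw [hb.left k hk _ (by omega)]
      cases k with
      | zero => exact .inl rfl
      | succ k =>
        rw [cell_west]
        exact .inr ⟨p, k, by omega, rfl⟩
  · rintro ⟨p, k, hk, rfl⟩ a' ⟨p', rfl, l, hl, heq⟩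
    have ht := (hm p).lt
    have hj := (hm p).j_le
    have ht' := (hm p').lt
    -- By disjointness of boxes, crossing lines belong to the same box, so they cross at its queried
    -- cell.
    obtain ⟨hpp, rfl, hl⟩ := (hm p).box.eq_of_cell_eq (hm p').box hk (by omega) (hm p').i_le
      (by omega) heq
    obtain rfl := Subtype.ext hpp
    exact (hm p).ne

/-- Acceptance involves runs of unbounded length; here its absence in all quadrants becomes a single
alternation over finite alphabets with a local condition. -/
theorem forall_not_accepts_iff [Nonempty M.Label] (hK : 2 ≤ K)
    (hbelow : ∀ i, (M.act i).Below K) (x : Config A) :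
    (∀ p, ¬ M.Accepts fun i j => x (cell p i j)) ↔
      ∀ Y : Config (TileLetter M K), ∃ Z, ∀ c, RuleAt x Y Z c := by
  refine ⟨exists_search_of_not_accepts hK hbelow x, fun h p hp => ?_⟩
  obtain ⟨Y, hY⟩ := exists_tableau_of_accepts hK hbelow x p hp
  obtain ⟨Z, hZ⟩ := h Y
  obtain ⟨c, hc⟩ := hY Z
  exact hc (hZ c)

end UMSO

namespace UMSO

open Function Relation

/-! ### Quantifier prefixes -/

/-- Put a configuration in front of a sequence of configurations. -/
def consStream {α : Type*} (X : α) (Y : ℕ → α) : ℕ → α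
  | 0 => X
  | n + 1 => Y n

/-- Put finitely many terms in front of a sequence. -/
def appendStream {α : Type*} {m : ℕ} (X : Fin m → α) (Y : ℕ → α) : ℕ → α :=
  fun n => if h : n < m then X ⟨n, h⟩ else Y (n - m)

theorem appendStream_cons {α : Type*} {m : ℕ} (X : α) (Y : Fin m → α) (Z : ℕ → α) :
    appendStream (Fin.cons X Y : Fin (m + 1) → α) Z = consStream X (appendStream Y Z) := by
  funext n
  cases n with
  | zero => rfl
  | succ n =>
    by_cases h : n < m
    · simp only [appendStream, consStream, Nat.add_lt_add_iff_right, h, dite_true]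
      exact Fin.cons_succ (α := fun _ => α) X Y ⟨n, h⟩
    · simp [appendStream, consStream, h]

theorem appendStream_zero {α : Type*} (X : Fin 0 → α) (Y : ℕ → α) : appendStream X Y = Y := by
  funext n; simp [appendStream]

/-- A prefix of quantifiers applied to a predicate of a sequence of configurations. -/
def quantStream : List Quant → ((ℕ → Config (Fin 2)) → Prop) → Prop
  | [], p => p fun _ _ => 0
  | q :: Q, p => q.Interp fun X => quantStream Q fun Y => p (consStream X Y)

theorem Quant.interp_congr (q : Quant) {p p' : Config (Fin 2) → Prop} (h : ∀ X, p X ↔ p' X) :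
    q.Interp p ↔ q.Interp p' := by
  cases q
  · exact forall_congr' h
  · exact exists_congr h

theorem Quant.interp_const (q : Quant) (P : Prop) : q.Interp (fun _ => P) ↔ P := by
  cases q
  · exact forall_const _
  · exact exists_const _

/-- Sequences that continue with zero replace tuples whose length depends on the prefix, so prefixes
can be split and extended without casts. -/
theorem quantify_iff_quantStream (Q : List Quant) (p : (ℕ → Config (Fin 2)) → Prop) :
    quantify Q (fun X => p (appendStream X fun _ _ => 0)) ↔ quantStream Q p := by
  induction Q generalizing p with
  | nil => rw [quantify, quantStream, appendStream_zero]
  | cons q Q ih =>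
    refine q.interp_congr fun X => ?_
    rw [← ih]
    exact iff_of_eq (congrArg _ (funext fun Y => congrArg p (appendStream_cons X Y _)))

theorem quantStream_const (Q : List Quant) (P : Prop) : quantStream Q (fun _ => P) ↔ P := by
  induction Q with
  | nil => exact Iff.rfl
  | cons q Q ih => exact (q.interp_congr fun _ => ih).trans (q.interp_const P)

/-- Dummy quantifiers in front do not matter; those at the end are handled by `quantStream_const`.
They pad a prefix to the required number of blocks. -/
theorem quantStream_append_left (Q Q' : List Quant) (p : (ℕ → Config (Fin 2)) → Prop) :
    quantStream (Q ++ Q') (fun X => p fun n => X (n + Q.length)) ↔ quantStream Q' p := by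
  induction Q with
  | nil => exact Iff.rfl
  | cons q Q ih => exact (q.interp_congr fun _ => ih).trans (q.interp_const _)

theorem quantStream_replicate_all (m : ℕ) (Q : List Quant) (p : (ℕ → Config (Fin 2)) → Prop) :
    quantStream (List.replicate m .all ++ Q) p ↔
      ∀ X : Fin m → Config (Fin 2), quantStream Q fun Y => p (appendStream X Y) := by
  induction m generalizing p with
  | zero => simp [appendStream_zero]
  | succ m ih =>
    rw [Fin.forall_fin_succ_pi]
    refine forall_congr' fun X => ?_
    refine (ih _).trans ?_
    simp only [appendStream_cons]

theorem quantStream_replicate_ex (m : ℕ) (Q : List Quant) (p : (ℕ → Config (Fin 2)) → Prop) :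
    quantStream (List.replicate m .ex ++ Q) p ↔
      ∃ X : Fin m → Config (Fin 2), quantStream Q fun Y => p (appendStream X Y) := by
  induction m generalizing p with
  | zero => simp [appendStream_zero]
  | succ m ih =>
    rw [Fin.exists_fin_succ_pi]
    refine exists_congr fun X => ?_
    refine (ih _).trans ?_
    simp only [appendStream_cons]

theorem numBlocks_replicate_append (m : ℕ) (q : Quant) (Q : List Quant)
    (hQ : Q.head? ≠ some q) : numBlocks (List.replicate (m + 1) q ++ Q) = numBlocks Q + 1 := by
  induction m with
  | zero =>
    cases Q with
    | nil => rfl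
    | cons r Q =>
      have : q ≠ r := by rintro rfl; simp at hQ
      simp [numBlocks, this]
  | succ m ih => simpa [List.replicate_succ, numBlocks] using ih

/-- An alternating list of quantifiers. -/
def altQuants (q : Quant) : ℕ → List Quant
  | 0 => []
  | n + 1 => q :: altQuants (if q = .all then .ex else .all) n

theorem head?_altQuants_ne (q r : Quant) (n : ℕ) (h : q ≠ r) :
    (altQuants q n).head? ≠ some r := by
  cases n with
  | zero => simp [altQuants]
  | succ n => simpa [altQuants] using h

theorem numBlocks_altQuants (q : Quant) (n : ℕ) : numBlocks (altQuants q n) = n := by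
  induction n generalizing q with
  | zero => rfl
  | succ n ih =>
    have := numBlocks_replicate_append 0 q (altQuants (if q = .all then .ex else .all) n)
      (head?_altQuants_ne _ _ _ (by cases q <;> simp))
    rw [ih] at this
    simpa [altQuants] using this

/-! ### Definability of local conditions -/

variable {A : Type u}

/-- A predicate that is expressed by a quantifier-free formula. -/
def Expressible (m l : ℕ)
    (Ψ : Config A → (ℕ → Config (Fin 2)) → (Fin l → ℤ × ℤ) → Prop) : Prop :=
  ∃ φ : QFFormula A m l, ∀ x X v, φ.Holds x (fun j => X j) v ↔ Ψ x X v

variable {m l : ℕ}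

theorem Expressible.of_iff
    {Ψ Ψ' : Config A → (ℕ → Config (Fin 2)) → (Fin l → ℤ × ℤ) → Prop}
    (h : Expressible m l Ψ) (h' : ∀ x X v, Ψ' x X v ↔ Ψ x X v) : Expressible m l Ψ' := by
  obtain ⟨φ, hφ⟩ := h
  exact ⟨φ, fun x X v => (hφ x X v).trans (h' x X v).symm⟩

/-- A term is needed to write any atomic formula, hence at least one first-order variable. -/
theorem expressible_const (P : Prop) :
    Expressible (A := A) m (l + 1) fun _ _ _ => P := by
  by_cases hP : P
  · exact ⟨.eq (.var 0) (.var 0), by simp [QFFormula.Holds, hP]⟩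
  · exact ⟨.neg (.eq (.var 0) (.var 0)), by simp [QFFormula.Holds, hP]⟩

theorem Expressible.and {Ψ Ψ' : Config A → (ℕ → Config (Fin 2)) → (Fin l → ℤ × ℤ) → Prop}
    (h : Expressible m l Ψ) (h' : Expressible m l Ψ') :
    Expressible m l fun x X v => Ψ x X v ∧ Ψ' x X v := by
  obtain ⟨φ, hφ⟩ := h
  obtain ⟨φ', hφ'⟩ := h'
  exact ⟨.and φ φ', fun x X v => and_congr (hφ x X v) (hφ' x X v)⟩

theorem Expressible.or {Ψ Ψ' : Config A → (ℕ → Config (Fin 2)) → (Fin l → ℤ × ℤ) → Prop}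
    (h : Expressible m l Ψ) (h' : Expressible m l Ψ') :
    Expressible m l fun x X v => Ψ x X v ∨ Ψ' x X v := by
  obtain ⟨φ, hφ⟩ := h
  obtain ⟨φ', hφ'⟩ := h'
  exact ⟨.or φ φ', fun x X v => or_congr (hφ x X v) (hφ' x X v)⟩

theorem Expressible.forall {T : Type*} [Finite T]
    {Ψ : T → Config A → (ℕ → Config (Fin 2)) → (Fin (l + 1) → ℤ × ℤ) → Prop}
    (h : ∀ t, Expressible m (l + 1) (Ψ t)) :
    Expressible m (l + 1) fun x X v => ∀ t, Ψ t x X v := by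
  have key : ∀ s : Set T, s.Finite → Expressible m (l + 1) fun x X v => ∀ t ∈ s, Ψ t x X v := by
    intro s hs
    induction s, hs using Set.Finite.induction_on with
    | empty => exact (expressible_const True).of_iff (by simp)
    | @insert t _ _ _ ih => exact ((h t).and ih).of_iff (by simp)
  exact (key _ Set.finite_univ).of_iff (by simp)

theorem Expressible.exists {T : Type*} [Finite T]
    {Ψ : T → Config A → (ℕ → Config (Fin 2)) → (Fin (l + 1) → ℤ × ℤ) → Prop}
    (h : ∀ t, Expressible m (l + 1) (Ψ t)) :
    Expressible m (l + 1) fun x X v => ∃ t, Ψ t x X v := by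
  have key : ∀ s : Set T, s.Finite → Expressible m (l + 1) fun x X v => ∃ t ∈ s, Ψ t x X v := by
    intro s hs
    induction s, hs using Set.Finite.induction_on with
    | empty => exact (expressible_const False).of_iff (by simp)
    | @insert t _ _ _ ih => exact ((h t).or ih).of_iff (by simp)
  exact (key _ Set.finite_univ).of_iff (by simp)

theorem exists_term_eval_eq_add (d : ℤ × ℤ) :
    ∃ t : Term 1, ∀ v, t.eval v = v 0 + d := by
  have h1 : ∀ k : ℤ, ∃ t : Term 1, ∀ v, t.eval v = v 0 + (k, 0) := by
    intro k
    induction k using Int.induction_on with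
    | zero => exact ⟨.var 0, by simp [Term.eval]⟩
    | succ k ih =>
      obtain ⟨t, ht⟩ := ih
      exact ⟨.app .east t, fun v => by simp [Term.eval, ht, Dir.move, Prod.ext_iff, add_assoc]⟩
    | pred k ih =>
      obtain ⟨t, ht⟩ := ih
      exact ⟨.app .west t, fun v => by simp [Term.eval, ht, Dir.move, Prod.ext_iff, add_sub_assoc]⟩
  obtain ⟨i, j⟩ := d
  induction j using Int.induction_on with
  | zero => exact h1 i
  | succ k ih =>
    obtain ⟨t, ht⟩ := ih
    exact ⟨.app .north t, fun v => by simp [Term.eval, ht, Dir.move, Prod.ext_iff, add_assoc]⟩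
  | pred k ih =>
    obtain ⟨t, ht⟩ := ih
    exact ⟨.app .south t, fun v => by simp [Term.eval, ht, Dir.move, Prod.ext_iff, add_sub_assoc]⟩

theorem expressible_symb (a : A) (d : ℤ × ℤ) :
    Expressible m 1 fun x _ v => x (v 0 + d) = a := by
  obtain ⟨t, ht⟩ := exists_term_eval_eq_add d
  exact ⟨.symb a t, fun x X v => by rw [QFFormula.Holds, ht]⟩

theorem expressible_conf {j : ℕ} (hj : j < m) (b : Fin 2) (d : ℤ × ℤ) :
    Expressible (A := A) m 1 fun _ X v => X j (v 0 + d) = b := by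
  obtain ⟨t, ht⟩ := exists_term_eval_eq_add d
  exact ⟨.conf ⟨j, hj⟩ t b, fun x X v => by rw [QFFormula.Holds, ht]⟩

/-- Only finitely many neighbourhoods exist, so the condition is the disjunction, over those allowed
by `Φ`, of the statement that this neighbourhood is seen. -/
theorem expressible_of_finite [Finite A] {n m₁ m₂ k : ℕ} (hm : k + m₁ + m₂ ≤ m)
    (off : Fin n → ℤ × ℤ)
    (Φ : (Fin n → A × (Fin m₁ → Fin 2) × (Fin m₂ → Fin 2)) → Prop) :
    Expressible m 1 fun x X v => Φ fun i => (x (v 0 + off i),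
      fun j => X (j + k) (v 0 + off i), fun j => X (j + m₁ + k) (v 0 + off i)) := by
  have h : ∀ τ : Fin n → A × (Fin m₁ → Fin 2) × (Fin m₂ → Fin 2), Expressible m 1 fun x X v =>
      Φ τ ∧ ∀ i, x (v 0 + off i) = (τ i).1 ∧ (∀ j : Fin m₁, X (j + k) (v 0 + off i) = (τ i).2.1 j) ∧
        ∀ j : Fin m₂, X (j + m₁ + k) (v 0 + off i) = (τ i).2.2 j := fun τ =>
    (expressible_const _).and (Expressible.forall fun i => (expressible_symb _ _).and
      ((Expressible.forall fun j => expressible_conf (by omega) _ _).and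
        (Expressible.forall fun j => expressible_conf (by omega) _ _)))
  refine (Expressible.exists h).of_iff fun x X v => ⟨fun hΦ => ⟨_, hΦ, by simp⟩, ?_⟩
  rintro ⟨τ, hΦ, hτ⟩
  convert hΦ using 2 with i
  obtain ⟨h1, h2, h3⟩ := hτ i
  exact Prod.ext h1 (Prod.ext (funext h2) (funext h3))

/-- Unit vectors serve as codes. The length is written as a successor because the quantifier blocks
must be nonempty. -/
theorem exists_binary_coding (B : Type*) [Finite B] [Nonempty B] :
    ∃ (m : ℕ) (c : B → Fin (m + 1) → Fin 2) (d : (Fin (m + 1) → Fin 2) → B),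
      ∀ b, d (c b) = b := by
  classical
  have := Fintype.ofFinite B
  obtain ⟨m, hm⟩ := Nat.exists_eq_succ_of_ne_zero (Fintype.card_ne_zero (α := B))
  let e : B ≃ Fin (m + 1) := Fintype.equivFinOfCardEq hm
  let c : B → Fin (m + 1) → Fin 2 := fun b j => if e b = j then 1 else 0
  have hc : Injective c := by
    intro b b' h
    have := congrFun h (e b')
    simp only [c, if_true] at this
    by_contra hne
    rw [if_neg (e.injective.ne hne)] at this
    exact absurd this (by decide)
  exact ⟨m, c, invFun c, leftInverse_invFun hc⟩

/-- The set of configurations defined by a universal and an existential quantifier over finite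
alphabets and a local condition is defined by a formula with a prefix that contains a universal
block followed by an existential one. -/
theorem exists_formula_of_local [Finite A] {B C : Type*} [Finite B] [Finite C] [Nonempty B]
    [Nonempty C] {n : ℕ} (off : Fin n → ℤ × ℤ) (Φ : (Fin n → A × B × C) → Prop) :
    ∃ m₁ m₂ : ℕ, ∀ Q Q' : List Quant, ∃ φ : Formula A,
      φ.quants = Q ++ (List.replicate (m₁ + 1) .all ++ (List.replicate (m₂ + 1) .ex ++ Q')) ∧
      φ.modelSet = {x | ∀ Y : Config B, ∃ Z : Config C, ∀ c,
        Φ fun i => (x (c + off i), Y (c + off i), Z (c + off i))} := by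
  obtain ⟨m₁, c₁, d₁, h₁⟩ := exists_binary_coding B
  obtain ⟨m₂, c₂, d₂, h₂⟩ := exists_binary_coding C
  refine ⟨m₁, m₂, fun Q Q' => ?_⟩
  set R := Q ++ (List.replicate (m₁ + 1) .all ++ (List.replicate (m₂ + 1) .ex ++ Q')) with hR
  obtain ⟨φ, hφ⟩ := expressible_of_finite (m := R.length) (m₁ := m₁ + 1) (m₂ := m₂ + 1)
    (k := Q.length) (by simp [hR]; omega) off fun τ : Fin n → A × _ × _ =>
      Φ fun i => ((τ i).1, d₁ (τ i).2.1, d₂ (τ i).2.2)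
  refine ⟨⟨R, 1, φ⟩, rfl, Set.ext fun x => ?_⟩
  let p : (ℕ → Config (Fin 2)) → Prop := fun X => ∀ v : Fin 1 → ℤ × ℤ, Φ fun i =>
    (x (v 0 + off i), d₁ fun j => X j (v 0 + off i), d₂ fun j => X (j + (m₁ + 1)) (v 0 + off i))
  have key : (⟨R, 1, φ⟩ : Formula A).Models x ↔
      quantStream R fun X => p fun n => X (n + Q.length) := by
    rw [← quantify_iff_quantStream]
    refine iff_of_eq (congrArg (quantify R) (funext fun X => ?_))
    have hX : X = fun j : Fin R.length => appendStream X (fun _ _ => 0) j := by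
      funext j
      simp [appendStream]
    conv_lhs => rw [hX]
    simp only [hφ, p]
  change (⟨R, 1, φ⟩ : Formula A).Models x ↔ _
  rw [key, hR, quantStream_append_left, quantStream_replicate_all]
  simp only [quantStream_replicate_ex]
  have hp : ∀ (X : Fin (m₁ + 1) → Config (Fin 2)) (Y : Fin (m₂ + 1) → Config (Fin 2))
      (Z : ℕ → Config (Fin 2)), p (appendStream X (appendStream Y Z)) ↔ ∀ c, Φ fun i =>
        (x (c + off i), d₁ fun j => X j (c + off i), d₂ fun j => Y j (c + off i)) := by
    intro X Y Z
    have e1 : ∀ j : Fin (m₁ + 1), appendStream X (appendStream Y Z) j = X j := by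
      exact fun j => dif_pos j.2
    have e2 : ∀ j : Fin (m₂ + 1), appendStream X (appendStream Y Z) (j + (m₁ + 1)) = Y j := by
      intro j
      rw [appendStream, dif_neg (by omega), appendStream, dif_pos (by omega)]
      simp
    simp only [p, e1, e2]
    exact ⟨fun h c => h fun _ => c, fun h v => h (v 0)⟩
  simp only [hp, quantStream_const, Set.mem_ofPred_eq]
  -- Coding followed by decoding is the identity, so all configurations over `B` and `C` are
  -- reached; binary tuples that are not codes still decode to some letter.
  constructor
  · intro h Y
    obtain ⟨Z, hZ⟩ := h fun j c => c₁ (Y c) j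
    refine ⟨fun c => d₂ fun j => Z j c, fun c => ?_⟩
    have := hZ c
    simp only [h₁] at this
    exact this
  · intro h X
    obtain ⟨Z, hZ⟩ := h fun c => d₁ fun j => X j c
    refine ⟨fun j c => c₂ (Z c) j, fun c => ?_⟩
    simp only [h₂]
    exact hZ c

/-- The sets of `exists_formula_of_local` belong to all levels of the hierarchy that allow two
alternating blocks starting with a universal one. -/
theorem mem_levels_of_local [Finite A] {B C : Type*} [Finite B] [Finite C] [Nonempty B]
    [Nonempty C] {k : ℕ} (off : Fin k → ℤ × ℤ) (Φ : (Fin k → A × B × C) → Prop)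
    {S : Set (Config A)} (hS : S = {x | ∀ Y : Config B, ∃ Z : Config C, ∀ c,
        Φ fun i => (x (c + off i), Y (c + off i), Z (c + off i))}) :
    (∀ n, 2 ≤ n → S ∈ piBar A n) ∧ ∀ n, 3 ≤ n → S ∈ sigmaBar A n := by
  obtain ⟨m₁, m₂, h⟩ := exists_formula_of_local off Φ
  have hblocks : ∀ n, numBlocks (List.replicate (m₁ + 1) Quant.all ++
      (List.replicate (m₂ + 1) .ex ++ altQuants .all n)) = n + 2 := by
    intro n
    rw [numBlocks_replicate_append _ _ _ (by simp [List.replicate_succ]),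
      numBlocks_replicate_append _ _ _ (head?_altQuants_ne _ _ _ (by simp)), numBlocks_altQuants]
  constructor
  · intro n hn
    obtain ⟨φ, hQ, hφ⟩ := h [] (altQuants .all (n - 2))
    refine ⟨φ, ⟨?_, ?_⟩, by rw [hφ, hS]⟩
    · rw [hQ, List.nil_append, hblocks]; omega
    · rw [hQ]; simp [List.replicate_succ]
  · intro n hn
    -- A dummy existential quantifier forms the first block.
    obtain ⟨φ, hQ, hφ⟩ := h [.ex] (altQuants .all (n - 3))
    refine ⟨φ, ⟨?_, ?_⟩, by rw [hφ, hS]⟩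
    · rw [hQ]
      have := numBlocks_replicate_append 0 .ex (List.replicate (m₁ + 1) Quant.all ++
        (List.replicate (m₂ + 1) .ex ++ altQuants .all (n - 3))) (by simp [List.replicate_succ])
      rw [hblocks] at this
      refine this.trans ?_
      omega
    · rw [hQ]; simp

end UMSO

namespace UMSO

open Function Relation

/-! ### Effectively closed subshifts are definable -/

theorem Int.encode_natCast (n : ℕ) : Encodable.encode (n : ℤ) = 2 * n := rfl

theorem Int.encode_negSucc (n : ℕ) : Encodable.encode (Int.negSucc n) = 2 * n + 1 := rfl

theorem Int.primrec_natCast : Primrec (fun n : ℕ => (n : ℤ)) :=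
  Primrec.encode_iff.1 Primrec.nat_double

variable {A : Type u}

/-- A forbidden pattern can be translated to natural coordinates, which registers can hold. A list
that assigns two letters to one cell is the code of no pattern, but it matches no configuration
either. -/
theorem notMem_iff_exists_code {X : Set (Config A)} (hX : IsSubshift X) {k : ℕ} (e : A ≃ Fin k)
    (x : Config A) : x ∉ X ↔ ∃ p, ∃ L : List ((ℕ × ℕ) × Fin k),
      (¬ ∃ P ∈ language X, P.IsCode e (L.map fun c => (((c.1.1 : ℤ), (c.1.2 : ℤ)), c.2))) ∧
      ∀ c ∈ L, e (x (cell p c.1.1 c.1.2)) = c.2 := by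
  constructor
  · intro hx
    obtain ⟨F, rfl⟩ := hX
    simp only [avoiding, Set.mem_ofPred_eq, not_forall, not_not] at hx
    obtain ⟨P, hPF, v, hv⟩ := hx
    obtain ⟨b, hb⟩ : ∃ b : ℤ, ∀ w ∈ P.dom, b ≤ w.1 ∧ b ≤ w.2 := by
      obtain ⟨b₁, h₁⟩ := (P.dom.image Prod.fst).bddBelow
      obtain ⟨b₂, h₂⟩ := (P.dom.image Prod.snd).bddBelow
      exact ⟨min b₁ b₂, fun w hw =>
        ⟨(min_le_left _ _).trans (h₁ (by simpa using ⟨w.2, hw⟩)),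
          (min_le_right _ _).trans (h₂ (by simpa using ⟨w.1, hw⟩))⟩⟩
    refine ⟨v + (b, b), P.dom.attach.toList.map fun w =>
      (((w.1.1 - b).toNat, (w.1.2 - b).toNat), e (P.val w)), ?_, ?_⟩
    · rintro ⟨P', ⟨y, hy, v', hv'⟩, hcode⟩
      -- A pattern with this code would be a translate of `P`, so an occurrence in `y` yields one of
      -- `P`.
      refine hy P hPF ⟨v' - (b, b), fun w => ?_⟩
      have hmem := (hcode (w.1 - (b, b)) (P.val w)).1 (by
        refine List.mem_map.2 ⟨_, List.mem_map.2 ⟨w, by simp, rfl⟩, ?_⟩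
        have := hb w.1 w.2
        simp only [and_true, Prod.ext_iff, Prod.fst_sub, Prod.snd_sub]
        omega)
      obtain ⟨h, hval⟩ := hmem
      rw [← hval, ← hv' ⟨_, h⟩]
      exact congrArg y ((by abel : v' - (b, b) + w.1 = v' + (w.1 - (b, b))))
    · intro c hc
      obtain ⟨w, -, rfl⟩ := List.mem_map.1 hc
      have := hb w.1 w.2
      rw [← hv w]
      congr 2
      simp only [cell, Prod.ext_iff, Prod.fst_add, Prod.snd_add]
      omega
  · rintro ⟨p, L, hL, hmatch⟩ hx
    classical
    let D : Finset (ℤ × ℤ) := (L.map fun c => ((c.1.1 : ℤ), (c.1.2 : ℤ))).toFinset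
    refine hL ⟨⟨D, fun w => x (p + w)⟩, ⟨x, hx, p, fun w => rfl⟩, fun v a => ?_⟩
    have hD : v ∈ D ↔ ∃ c ∈ L, ((c.1.1 : ℤ), (c.1.2 : ℤ)) = v := by simp [D]
    simp only [List.mem_map, Prod.mk.injEq, exists_prop]
    constructor
    · rintro ⟨c, hc, rfl, he⟩
      refine ⟨hD.2 ⟨c, hc, rfl⟩, ?_⟩
      rw [← hmatch c hc] at he
      exact e.injective he
    · rintro ⟨hv, rfl⟩
      obtain ⟨c, hc, rfl⟩ := hD.1 hv
      exact ⟨c, hc, rfl, (hmatch c hc).symm⟩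

theorem mem_levels_of_mem_piZeroOne [Finite A] {X : Set (Config A)} (hX : X ∈ piZeroOne A) :
    (∀ n, 2 ≤ n → X ∈ piBar A n) ∧ ∀ n, 3 ≤ n → X ∈ sigmaBar A n := by
  obtain ⟨hsub, k, e, hre⟩ := hX
  let f : (ℕ × ℕ) × Fin k → (ℤ × ℤ) × Fin k := fun c => (((c.1.1 : ℤ), (c.1.2 : ℤ)), c.2)
  have hf : Primrec f :=
    ((Int.primrec_natCast.comp (Primrec.fst.comp .fst)).pair
      (Int.primrec_natCast.comp (Primrec.snd.comp .fst))).pair .snd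
  have hmap : Computable (List.map f) := (Primrec.list_map .id (hf.comp .snd).to₂).to_comp
  obtain ⟨P, hP⟩ := exists_prog_of_rePred e (W := fun L => ¬ ∃ P ∈ language X, P.IsCode e (L.map f))
    (Partrec.comp hre hmap)
  let M := P.machine
  obtain ⟨K, hK, hbelow⟩ := M.exists_below
  have : Nonempty M.Label := ⟨⟨.skip, P.skip_mem_acts⟩⟩
  have : Nonempty (TileLetter M K) :=
    ⟨⟨True, True, True, True, M.start, Classical.arbitrary _, fun _ => True⟩⟩
  have : Nonempty (SearchLetter A) := ⟨⟨True, True, True, fun _ => True, True⟩⟩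
  have hmem : ∀ x, x ∈ X ↔ ∀ p, ¬ M.Accepts fun i j => x (cell p i j) := by
    intro x
    rw [← not_iff_not, notMem_iff_exists_code hsub e]
    simp only [not_forall, not_not, M, f, Prog.machine_accepts_iff, hP]
  refine mem_levels_of_local (B := TileLetter M K) (C := SearchLetter A)
    ![0, (1, 0), (0, 1), (1, 1), (-1, 0), (0, -1)]
    (fun τ => SearchRule (τ 0).1 (τ 0).2.1 (τ 1).2.1 (τ 2).2.1 (τ 3).2.1
      (τ 0).2.2 (τ 1).2.2 (τ 4).2.2 (τ 2).2.2 (τ 5).2.2) (Set.ext fun x => ?_)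
  rw [hmem, forall_not_accepts_iff hK hbelow]
  simp [RuleAt]

end UMSO

namespace UMSO

open Function Relation

/-! ### Effectively open sets of configurations -/

/-- Nonnegative integers have even codes and negative ones odd codes. The successor adds 2 to an
even code and subtracts 2 from an odd one, except that the code 1 of `-1` goes to 0. -/
theorem Int.primrec_add_one : Primrec (fun z : ℤ => z + 1) := by
  refine (Primrec.ofNat_iff (f := fun z : ℤ => z + 1)).2 ?_
  have h : ∀ n : ℕ, Encodable.encode (Denumerable.ofNat ℤ n + 1) =
      if n % 2 = 0 then n + 2 else if n = 1 then 0 else n - 2 := by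
    intro n
    obtain ⟨z, rfl⟩ : ∃ z : ℤ, n = Encodable.encode z :=
      ⟨Denumerable.ofNat ℤ n, (Denumerable.encode_ofNat n).symm⟩
    rw [Denumerable.ofNat_encode]
    rcases z with m | m
    · have : Int.ofNat m + 1 = ((m + 1 : ℕ) : ℤ) := rfl
      rw [this, Int.encode_natCast]
      have : Encodable.encode (Int.ofNat m) = 2 * m := Int.encode_natCast m
      rw [this, if_pos (by omega)]
      omega
    · rw [Int.encode_negSucc, if_neg (by omega)]
      cases m with
      | zero => rfl
      | succ m =>
        have : Int.negSucc (m + 1) + 1 = Int.negSucc m := by omega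
        rw [this, Int.encode_negSucc, if_neg (by omega)]
        omega
  refine Primrec.encode_iff.1 (Primrec.of_eq ?_ fun n => (h n).symm)
  exact Primrec.ite (Primrec.eq.comp (Primrec.nat_mod.comp .id (.const 2)) (.const 0))
    (Primrec.nat_add.comp .id (.const 2))
    (Primrec.ite (Primrec.eq.comp .id (.const 1)) (.const 0) (Primrec.nat_sub.comp .id (.const 2)))

theorem Int.primrec_sub_one : Primrec (fun z : ℤ => z - 1) := by
  refine (Primrec.ofNat_iff (f := fun z : ℤ => z - 1)).2 ?_
  have h : ∀ n : ℕ, Encodable.encode (Denumerable.ofNat ℤ n - 1) =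
      if n % 2 = 1 then n + 2 else if n = 0 then 1 else n - 2 := by
    intro n
    obtain ⟨z, rfl⟩ : ∃ z : ℤ, n = Encodable.encode z :=
      ⟨Denumerable.ofNat ℤ n, (Denumerable.encode_ofNat n).symm⟩
    rw [Denumerable.ofNat_encode]
    rcases z with m | m
    · have hm : Encodable.encode (Int.ofNat m) = 2 * m := Int.encode_natCast m
      rw [hm, if_neg (by omega)]
      cases m with
      | zero => rfl
      | succ m =>
        have : Int.ofNat (m + 1) - 1 = (m : ℤ) := by simp
        rw [this, Int.encode_natCast, if_neg (by omega)]
        omega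
    · have : Int.negSucc m - 1 = Int.negSucc (m + 1) := by omega
      rw [this, Int.encode_negSucc, Int.encode_negSucc, if_pos (by omega)]
      omega
  refine Primrec.encode_iff.1 (Primrec.of_eq ?_ fun n => (h n).symm)
  exact Primrec.ite (Primrec.eq.comp (Primrec.nat_mod.comp .id (.const 2)) (.const 1))
    (Primrec.nat_add.comp .id (.const 2))
    (Primrec.ite (Primrec.eq.comp .id (.const 0)) (.const 1) (Primrec.nat_sub.comp .id (.const 2)))

theorem Dir.primrec_move (d : Dir) : Primrec d.move := by
  cases d
  · exact Primrec.fst.pair (Int.primrec_add_one.comp .snd)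
  · exact Primrec.fst.pair (Int.primrec_sub_one.comp .snd)
  · exact (Int.primrec_add_one.comp .fst).pair .snd
  · exact (Int.primrec_sub_one.comp .fst).pair .snd

theorem Term.primrec_eval {l : ℕ} (t : Term l) :
    Primrec fun v : Fin l → ℤ × ℤ => t.eval v := by
  induction t with
  | var i => exact Primrec.fin_app.comp .id (.const i)
  | app d t ih => exact d.primrec_move.comp ih

/-! ### Initial segments of configurations and compactness -/

/-- The number of a cell. -/
def cellIndex (v : ℤ × ℤ) : ℕ := Encodable.encode v

/-- The cell with a given number. -/
def cellOfIndex (i : ℕ) : ℤ × ℤ := Denumerable.ofNat (ℤ × ℤ) i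

theorem cellOfIndex_cellIndex (v : ℤ × ℤ) : cellOfIndex (cellIndex v) = v :=
  Denumerable.ofNat_encode v

theorem cellIndex_cellOfIndex (i : ℕ) : cellIndex (cellOfIndex i) = i :=
  Denumerable.encode_ofNat i

theorem primrec_cellIndex : Primrec cellIndex := Primrec.encode

/-- The first `n` terms of a sequence. -/
def initSeg (n : ℕ) (s : ℕ → ℕ) : List ℕ := List.ofFn fun i : Fin n => s i

theorem getD_initSeg {n i : ℕ} (h : i < n) (s : ℕ → ℕ) : (initSeg n s).getD i 0 = s i := by
  simp [initSeg, List.getD, h]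

theorem initSeg_congr {n : ℕ} {s s' : ℕ → ℕ} (h : ∀ i < n, s i = s' i) :
    initSeg n s = initSeg n s' := by
  simp only [initSeg]
  congr 1
  funext i
  exact h i i.2

/-- The words of length `n` over `{0, …, k - 1}`. -/
def words (k : ℕ) : ℕ → List (List ℕ)
  | 0 => [[]]
  | n + 1 => (words k n).flatMap fun w => (List.range k).map fun a => w ++ [a]

theorem mem_words_iff (k n : ℕ) (w : List ℕ) :
    w ∈ words k n ↔ ∃ s : ℕ → ℕ, (∀ i < n, s i < k) ∧ w = initSeg n s := by
  induction n generalizing w with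
  | zero => simp [words, initSeg]
  | succ n ih =>
    simp only [words, List.mem_flatMap, ih, List.mem_map, List.mem_range]
    constructor
    · rintro ⟨_, ⟨s, hs, rfl⟩, a, ha, rfl⟩
      refine ⟨update s n a, fun i hi => ?_, ?_⟩
      · by_cases h : i = n
        · subst h; simpa using ha
        · rw [update_of_ne h]; exact hs i (by omega)
      · rw [initSeg, initSeg, List.ofFn_succ', List.concat_eq_append]
        simp only [Fin.val_last, update_self, Fin.val_castSucc]
        congr 2
        funext i
        rw [update_of_ne i.2.ne]
    · rintro ⟨s, hs, rfl⟩
      refine ⟨_, ⟨s, fun i hi => hs i (by omega), rfl⟩, s n, hs n (by omega), ?_⟩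
      rw [initSeg, initSeg, List.ofFn_succ', List.concat_eq_append]
      rfl

theorem primrec_words (k : ℕ) : Primrec (words k) := by
  have h : Primrec₂ fun (_ : ℕ) (ws : List (List ℕ)) =>
      ws.flatMap fun w => (List.range k).map fun a => w ++ [a] := by
    refine Primrec.list_flatMap .snd (Primrec.list_map (.const _) ?_)
    exact (Primrec.list_concat.comp (Primrec.snd.comp .fst) .snd)
  refine (Primrec.nat_rec₁ [[]] h).of_eq fun n => ?_
  induction n with
  | zero => rfl
  | succ n ih => simp only [words, ← ih]

variable {A : Type u}

/-- A configuration as a sequence of numbers. -/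
def codeConfig {k : ℕ} (e : A ≃ Fin k) (x : Config A) : ℕ → ℕ :=
  fun i => e (x (cellOfIndex i))

theorem codeConfig_cellIndex {k : ℕ} (e : A ≃ Fin k) (x : Config A) (v : ℤ × ℤ) :
    codeConfig e x (cellIndex v) = e (x v) := by
  rw [codeConfig, cellOfIndex_cellIndex]

theorem initSeg_mem_words {k : ℕ} (e : A ≃ Fin k) (x : Config A) (n : ℕ) :
    initSeg n (codeConfig e x) ∈ words k n :=
  (mem_words_iff k n _).2 ⟨_, fun _ _ => Fin.is_lt _, rfl⟩

theorem exists_initSeg_eq [Nonempty A] {k n : ℕ} (e : A ≃ Fin k) {w : List ℕ}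
    (hw : w ∈ words k n) : ∃ x : Config A, initSeg n (codeConfig e x) = w := by
  obtain ⟨s, hs, rfl⟩ := (mem_words_iff k n w).1 hw
  refine ⟨fun v => if h : s (cellIndex v) < k then e.symm ⟨_, h⟩ else Classical.arbitrary A,
    initSeg_congr fun i hi => ?_⟩
  have := hs i hi
  simp [codeConfig, cellIndex_cellOfIndex, this]

/-- A form of compactness: if every configuration has an initial segment with the property `T`,
then so have all words of some length. -/
theorem forall_exists_initSeg_iff [Nonempty A] {k : ℕ} (e : A ≃ Fin k) (T : ℕ → List ℕ → Prop)
    (hT : ∀ (x : Config A) n, T n (initSeg n (codeConfig e x)) →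
      T (n + 1) (initSeg (n + 1) (codeConfig e x))) :
    (∀ x : Config A, ∃ n, T n (initSeg n (codeConfig e x))) ↔ ∃ n, ∀ w ∈ words k n, T n w := by
  constructor
  · intro h
    let _ : TopologicalSpace A := ⊥
    have : DiscreteTopology A := ⟨rfl⟩
    have : Finite A := Finite.of_equiv _ e.symm
    let O : ℕ → Set (Config A) := fun n => {x | T n (initSeg n (codeConfig e x))}
    have hO : ∀ n, IsOpen (O n) := by
      intro n
      let f : Config A → Fin n → A := fun x i => x (cellOfIndex i)
      have hf : Continuous f := continuous_pi fun i => continuous_apply _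
      have : O n = f ⁻¹' {g | T n (List.ofFn fun i => (e (g i) : ℕ))} := rfl
      rw [this]
      exact (isOpen_discrete _).preimage hf
    have hmono : Monotone O := monotone_nat_of_le_succ fun n x hx => hT x n hx
    -- The sets `O n` form an increasing open cover of the compact full shift, so one of them is
    -- everything.
    obtain ⟨n, hn⟩ := (isCompact_univ (X := Config A)).elim_directed_cover O hO
      (fun x _ => Set.mem_iUnion.2 (h x)) hmono.directed_le
    refine ⟨n, fun w hw => ?_⟩
    obtain ⟨x, rfl⟩ := exists_initSeg_eq e hw
    exact hn (Set.mem_univ x)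
  · rintro ⟨n, h⟩ x
    exact ⟨n, h _ (initSeg_mem_words e x n)⟩

/-! ### Effectively open predicates under second-order quantifiers -/

/-- Effectively open predicates of lists of sequences. -/
def EffOpen (V : List (ℕ → ℕ) → Prop) : Prop :=
  ∃ R : ℕ → List (List ℕ) → Prop, PrimrecRel R ∧
    (∀ s : List (ℕ → ℕ), V s ↔ ∃ n, R n (s.map (initSeg n))) ∧
    ∀ (s : List (ℕ → ℕ)) (n : ℕ), R n (s.map (initSeg n)) → R (n + 1) (s.map (initSeg (n + 1)))

/-- A binary configuration as a sequence of numbers. -/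
def codeBinary (X : Config (Fin 2)) : ℕ → ℕ := codeConfig (Equiv.refl (Fin 2)) X

/-- Only an initial segment of the witness is inspected, so it can be sought among finitely many
words; every word extends to a configuration. -/
theorem EffOpen.exists {V : List (ℕ → ℕ) → Prop} (hV : EffOpen V) :
    EffOpen fun s => ∃ X, V (codeBinary X :: s) := by
  obtain ⟨R, hR, hVR, hmono⟩ := hV
  have hiff : ∀ (s : List (ℕ → ℕ)) (n : ℕ), (∃ w ∈ words 2 n, R n (w :: s.map (initSeg n))) ↔
      ∃ X, R n ((codeBinary X :: s).map (initSeg n)) := by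
    intro s n
    constructor
    · rintro ⟨w, hw, h⟩
      obtain ⟨X, rfl⟩ := exists_initSeg_eq (Equiv.refl (Fin 2)) hw
      exact ⟨X, h⟩
    · rintro ⟨X, h⟩
      exact ⟨_, initSeg_mem_words (Equiv.refl (Fin 2)) X n, h⟩
  refine ⟨fun n L => ∃ w ∈ words 2 n, R n (w :: L), ?_, fun s => ?_, fun s n => ?_⟩
  · have h : PrimrecRel fun (w : List ℕ) (p : ℕ × List (List ℕ)) => R p.1 (w :: p.2) :=
      hR.comp (Primrec.fst.comp .snd) (Primrec.list_cons.comp .fst (Primrec.snd.comp .snd))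
    exact (PrimrecRel.exists_mem_list h).comp ((primrec_words 2).comp .fst) .id
  · simp only [hVR, hiff]
    exact exists_comm
  · intro h
    obtain ⟨X, h⟩ := (hiff s n).1 h
    exact (hiff s (n + 1)).2 ⟨X, hmono _ n h⟩

/-- By compactness one length works for all `X`, and for a fixed length there are finitely many
words to check. This is why alternation adds no power. -/
theorem EffOpen.forall {V : List (ℕ → ℕ) → Prop} (hV : EffOpen V) :
    EffOpen fun s => ∀ X, V (codeBinary X :: s) := by
  obtain ⟨R, hR, hVR, hmono⟩ := hV
  refine ⟨fun n L => ∀ w ∈ words 2 n, R n (w :: L), ?_, fun s => ?_, fun s n h w hw => ?_⟩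
  · have h : PrimrecRel fun (w : List ℕ) (p : ℕ × List (List ℕ)) => R p.1 (w :: p.2) :=
      hR.comp (Primrec.fst.comp .snd) (Primrec.list_cons.comp .fst (Primrec.snd.comp .snd))
    exact (PrimrecRel.forall_mem_list h).comp ((primrec_words 2).comp .fst) .id
  · simp only [hVR]
    exact forall_exists_initSeg_iff (Equiv.refl (Fin 2))
      (fun n w => R n (w :: s.map (initSeg n))) fun X n h => hmono (codeBinary X :: s) n h
  · obtain ⟨X, rfl⟩ := exists_initSeg_eq (Equiv.refl (Fin 2)) hw
    exact hmono (codeBinary X :: s) n (h _ (initSeg_mem_words (Equiv.refl (Fin 2)) X n))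

/-- A prefix of quantifiers applied to a predicate of lists of sequences. The innermost variable
comes first in the list. -/
def quantEnv : List Quant → (List (ℕ → ℕ) → Prop) → List (ℕ → ℕ) → Prop
  | [], U, s => U s
  | q :: Q, U, s => q.Interp fun X => quantEnv Q U (codeBinary X :: s)

theorem quantify_iff_quantEnv (Q : List Quant) (p : (Fin Q.length → Config (Fin 2)) → Prop)
    (U : List (ℕ → ℕ) → Prop) (s : List (ℕ → ℕ))
    (h : ∀ X, p X ↔ U ((List.ofFn X).reverse.map codeBinary ++ s)) :
    quantify Q p ↔ quantEnv Q U s := by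
  induction Q generalizing s with
  | nil => exact (h _).trans (by simp [quantEnv])
  | cons q Q ih =>
    refine q.interp_congr fun X => ih _ _ fun Y => ?_
    rw [h, List.ofFn_cons]
    simp

theorem EffOpen.not_quantEnv {U : List (ℕ → ℕ) → Prop} (hU : EffOpen fun s => ¬ U s)
    (Q : List Quant) : EffOpen fun s => ¬ quantEnv Q U s := by
  induction Q with
  | nil => exact hU
  | cons q Q ih =>
    cases q with
    | all =>
      have := ih.exists
      simpa only [quantEnv, Quant.Interp, not_forall] using this
    | ex =>
      have := ih.forall
      simpa only [quantEnv, Quant.Interp, not_exists] using this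

/-! ### Truth of the quantifier-free part on initial segments -/

/-- Truth of a quantifier-free formula, where the configuration `x` and the configuration variables
are given by the list `s` of their codes, in reverse order. -/
def QFFormula.HoldsEnv {k m l : ℕ} (e : A ≃ Fin k) (s : List (ℕ → ℕ)) (v : Fin l → ℤ × ℤ) :
    QFFormula A m l → Prop
  | .eq t t' => t.eval v = t'.eval v
  | .symb a t => s.getD m (fun _ => 0) (cellIndex (t.eval v)) = e a
  | .conf j t b => s.getD (m - 1 - j) (fun _ => 0) (cellIndex (t.eval v)) = b
  | .neg φ => ¬ φ.HoldsEnv e s v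
  | .and φ ψ => φ.HoldsEnv e s v ∧ ψ.HoldsEnv e s v
  | .or φ ψ => φ.HoldsEnv e s v ∨ ψ.HoldsEnv e s v

/-- Truth of a quantifier-free formula for given initial segments. -/
def QFFormula.HoldsSeg {k m l : ℕ} (e : A ≃ Fin k) (s : List (List ℕ)) (v : Fin l → ℤ × ℤ) :
    QFFormula A m l → Prop
  | .eq t t' => t.eval v = t'.eval v
  | .symb a t => (s.getD m []).getD (cellIndex (t.eval v)) 0 = e a
  | .conf j t b => (s.getD (m - 1 - j) []).getD (cellIndex (t.eval v)) 0 = b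
  | .neg φ => ¬ φ.HoldsSeg e s v
  | .and φ ψ => φ.HoldsSeg e s v ∧ ψ.HoldsSeg e s v
  | .or φ ψ => φ.HoldsSeg e s v ∨ ψ.HoldsSeg e s v

/-- All cells to which the formula refers have a number below `n`. -/
def QFFormula.Within {m l : ℕ} (n : ℕ) (v : Fin l → ℤ × ℤ) : QFFormula A m l → Prop
  | .eq _ _ => True
  | .symb _ t => cellIndex (t.eval v) < n
  | .conf _ t _ => cellIndex (t.eval v) < n
  | .neg φ => φ.Within n v
  | .and φ ψ => φ.Within n v ∧ ψ.Within n v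
  | .or φ ψ => φ.Within n v ∧ ψ.Within n v

theorem QFFormula.holds_iff_holdsEnv {k m l : ℕ} (e : A ≃ Fin k) (x : Config A)
    (X : Fin m → Config (Fin 2)) (v : Fin l → ℤ × ℤ) (φ : QFFormula A m l) :
    φ.Holds x X v ↔
      φ.HoldsEnv e ((List.ofFn X).reverse.map codeBinary ++ [codeConfig e x]) v := by
  induction φ with
  | eq t t' => exact Iff.rfl
  | symb a t =>
    have : ((List.ofFn X).reverse.map codeBinary ++ [codeConfig e x]).getD m (fun _ => 0) =
        codeConfig e x := by
      rw [List.getD, List.getElem?_append_right (by simp)]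
      simp
    rw [QFFormula.Holds, QFFormula.HoldsEnv, this, codeConfig_cellIndex, Fin.val_inj,
      e.injective.eq_iff]
  | conf j t b =>
    have : ((List.ofFn X).reverse.map codeBinary ++ [codeConfig e x]).getD (m - 1 - j)
        (fun _ => 0) = codeBinary (X j) := by
      have hj := j.2
      rw [List.getD, List.getElem?_append_left (by simp; omega), List.getElem?_map,
        List.getElem?_reverse (by simp; omega)]
      have : m - 1 - (m - 1 - (j : ℕ)) = j := by omega
      simp [this]
    rw [QFFormula.Holds, QFFormula.HoldsEnv, this, codeBinary, codeConfig_cellIndex, Fin.val_inj]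
    rfl
  | neg φ ih => exact not_congr ih
  | and φ ψ ih ih' => exact and_congr ih ih'
  | or φ ψ ih ih' => exact or_congr ih ih'

theorem getD_map_initSeg {n i : ℕ} (h : i < n) (s : List (ℕ → ℕ)) (j : ℕ) :
    ((s.map (initSeg n)).getD j []).getD i 0 = s.getD j (fun _ => 0) i := by
  by_cases hj : j < s.length
  · have h1 : (s.map (initSeg n)).getD j [] = initSeg n s[j] := by simp [List.getD, hj]
    have h2 : s.getD j (fun _ => 0) = s[j] := by simp [List.getD, hj]
    rw [h1, h2, getD_initSeg h]
  · simp [List.getD, hj]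

/-- A segment that is too short answers with the default 0, so its verdict is only used under
`Within`. -/
theorem QFFormula.holdsSeg_iff_holdsEnv {k m l n : ℕ} (e : A ≃ Fin k) (s : List (ℕ → ℕ))
    (v : Fin l → ℤ × ℤ) (φ : QFFormula A m l) (h : φ.Within n v) :
    φ.HoldsSeg e (s.map (initSeg n)) v ↔ φ.HoldsEnv e s v := by
  induction φ with
  | eq t t' => exact Iff.rfl
  | symb a t => rw [QFFormula.HoldsSeg, QFFormula.HoldsEnv, getD_map_initSeg h]
  | conf j t b => rw [QFFormula.HoldsSeg, QFFormula.HoldsEnv, getD_map_initSeg h]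
  | neg φ ih => exact not_congr (ih h)
  | and φ ψ ih ih' => exact and_congr (ih h.1) (ih' h.2)
  | or φ ψ ih ih' => exact or_congr (ih h.1) (ih' h.2)

theorem QFFormula.exists_within {m l : ℕ} (v : Fin l → ℤ × ℤ) (φ : QFFormula A m l) :
    ∃ n, ∀ n', n ≤ n' → φ.Within n' v := by
  induction φ with
  | eq t t' => exact ⟨0, fun _ _ => trivial⟩
  | symb a t => exact ⟨cellIndex (t.eval v) + 1, fun _ h => h⟩
  | conf j t b => exact ⟨cellIndex (t.eval v) + 1, fun _ h => h⟩
  | neg φ ih => exact ih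
  | and φ ψ ih ih' =>
    obtain ⟨n, hn⟩ := ih
    obtain ⟨n', hn'⟩ := ih'
    exact ⟨max n n', fun i hi => ⟨hn i (by omega), hn' i (by omega)⟩⟩
  | or φ ψ ih ih' =>
    obtain ⟨n, hn⟩ := ih
    obtain ⟨n', hn'⟩ := ih'
    exact ⟨max n n', fun i hi => ⟨hn i (by omega), hn' i (by omega)⟩⟩

theorem QFFormula.Within.succ {m l n : ℕ} {v : Fin l → ℤ × ℤ} {φ : QFFormula A m l}
    (h : φ.Within n v) : φ.Within (n + 1) v := by
  induction φ with
  | eq t t' => trivial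
  | symb a t => exact Nat.lt_succ_of_lt h
  | conf j t b => exact Nat.lt_succ_of_lt h
  | neg φ ih => exact ih h
  | and φ ψ ih ih' => exact ⟨ih h.1, ih' h.2⟩
  | or φ ψ ih ih' => exact ⟨ih h.1, ih' h.2⟩

theorem QFFormula.primrecPred_holdsSeg {k m l : ℕ} (e : A ≃ Fin k) (φ : QFFormula A m l) :
    PrimrecPred fun p : (Fin l → ℤ × ℤ) × List (List ℕ) => φ.HoldsSeg e p.2 p.1 := by
  have hlook : ∀ (j : ℕ) (t : Term l), Primrec fun p : (Fin l → ℤ × ℤ) × List (List ℕ) =>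
      (p.2.getD j []).getD (cellIndex (t.eval p.1)) 0 := fun j t =>
    (Primrec.list_getD 0).comp ((Primrec.list_getD []).comp .snd (.const j))
      (primrec_cellIndex.comp (t.primrec_eval.comp .fst))
  induction φ with
  | eq t t' => exact Primrec.eq.comp (t.primrec_eval.comp .fst) (t'.primrec_eval.comp .fst)
  | symb a t => exact Primrec.eq.comp (hlook m t) (.const _)
  | conf j t b => exact Primrec.eq.comp (hlook _ t) (.const _)
  | neg φ ih => exact ih.not
  | and φ ψ ih ih' => exact ih.and ih'
  | or φ ψ ih ih' => exact ih.or ih'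

theorem QFFormula.primrecPred_within {m l : ℕ} (φ : QFFormula A m l) :
    PrimrecPred fun p : (Fin l → ℤ × ℤ) × ℕ => φ.Within p.2 p.1 := by
  have hlt : ∀ t : Term l, PrimrecPred fun p : (Fin l → ℤ × ℤ) × ℕ =>
      cellIndex (t.eval p.1) < p.2 := fun t =>
    Primrec.nat_lt.comp (primrec_cellIndex.comp (t.primrec_eval.comp .fst)) .snd
  induction φ with
  | eq t t' => exact (Primrec.eq.comp (.const 0) (.const 0)).of_eq fun p => by simp [QFFormula.Within]
  | symb a t => exact hlt t
  | conf j t b => exact hlt t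
  | neg φ ih => exact ih
  | and φ ψ ih ih' => exact ih.and ih'
  | or φ ψ ih ih' => exact ih.and ih'

/-- A counterexample is sought among the assignments with codes below `n`, and accepted only if `n`
also exceeds all cells involved. Both bounds are kept when `n` grows. -/
theorem QFFormula.effOpen_not_forall {k m l : ℕ} (e : A ≃ Fin k) (φ : QFFormula A m l) :
    EffOpen fun s => ¬ ∀ v : Fin l → ℤ × ℤ, φ.HoldsEnv e s v := by
  let _ : Encodable (Fin l → ℤ × ℤ) := Primcodable.toEncodable
  refine ⟨fun n L => ∃ v ∈ (List.range n).filterMap (Encodable.decode (α := Fin l → ℤ × ℤ)),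
    φ.Within n v ∧ ¬ φ.HoldsSeg e L v, ?_, fun s => ?_, fun s n => ?_⟩
  · have h : PrimrecRel fun (v : Fin l → ℤ × ℤ) (p : ℕ × List (List ℕ)) =>
        φ.Within p.1 v ∧ ¬ φ.HoldsSeg e p.2 v :=
      (φ.primrecPred_within.comp (Primrec.fst.pair (Primrec.fst.comp .snd))).and
        ((φ.primrecPred_holdsSeg e).comp (Primrec.fst.pair (Primrec.snd.comp .snd))).not
    have hd : Primrec₂ fun (_ : ℕ × List (List ℕ)) (c : ℕ) =>
        Encodable.decode (α := Fin l → ℤ × ℤ) c := (Primrec.decode.comp Primrec.snd).to₂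
    exact (PrimrecRel.exists_mem_list h).comp
      (Primrec.listFilterMap (Primrec.list_range.comp .fst) hd) .id
  · simp only [not_forall, List.mem_filterMap, List.mem_range]
    constructor
    · rintro ⟨v, hv⟩
      obtain ⟨n, hn⟩ := φ.exists_within v
      have hw := hn (max n (Encodable.encode v + 1)) (le_max_left _ _)
      refine ⟨_, v, ⟨Encodable.encode v, by omega, Encodable.encodek v⟩, hw, ?_⟩
      rwa [φ.holdsSeg_iff_holdsEnv e s v hw]
    · rintro ⟨n, v, -, hw, hv⟩
      exact ⟨v, by rwa [φ.holdsSeg_iff_holdsEnv e s v hw] at hv⟩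
  · simp only [List.mem_filterMap, List.mem_range]
    rintro ⟨v, ⟨c, hc, hcv⟩, hw, hv⟩
    refine ⟨v, ⟨c, by omega, hcv⟩, hw.succ, ?_⟩
    rw [φ.holdsSeg_iff_holdsEnv e s v hw] at hv
    rwa [φ.holdsSeg_iff_holdsEnv e s v hw.succ]

/-- The complement of the set defined by a formula is effectively open. -/
theorem Formula.exists_primrecRel {k : ℕ} (e : A ≃ Fin k) (φ : Formula A) :
    ∃ R : ℕ → List ℕ → Prop, PrimrecRel R ∧
      (∀ x, x ∉ φ.modelSet ↔ ∃ n, R n (initSeg n (codeConfig e x))) ∧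
      ∀ x n, R n (initSeg n (codeConfig e x)) → R (n + 1) (initSeg (n + 1) (codeConfig e x)) := by
  obtain ⟨R, hR, hVR, hmono⟩ :=
    (φ.matrix.effOpen_not_forall e).not_quantEnv φ.quants
  refine ⟨fun n w => R n [w], ?_, fun x => ?_, fun x n h => hmono [codeConfig e x] n h⟩
  · exact hR.comp .fst (Primrec.list_cons.comp .snd (.const []))
  · refine Iff.trans (not_congr ?_) (hVR [codeConfig e x])
    exact quantify_iff_quantEnv _ _ _ _ fun X =>
      forall_congr' fun v => φ.matrix.holds_iff_holdsEnv e x X v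

/-! ### Sets defined by formulas are effectively closed subshifts -/

/-- Translations of configurations. -/
def shift {α : Type*} (d : ℤ × ℤ) (x : Config α) : Config α := fun v => x (v + d)

theorem shift_surjective {α : Type*} (d : ℤ × ℤ) : Surjective (shift (α := α) d) := fun x =>
  ⟨shift (-d) x, funext fun v => by simp [shift]⟩

/-- Translation is surjective on the full shift, so it is a change of variable under either
quantifier. -/
theorem quantify_shift (d : ℤ × ℤ) (Q : List Quant)
    (p : (Fin Q.length → Config (Fin 2)) → Prop) :
    quantify Q (fun X => p fun j => shift d (X j)) ↔ quantify Q p := by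
  induction Q with
  | nil => exact iff_of_eq (congrArg p (funext fun j => j.elim0))
  | cons q Q ih =>
    have h : ∀ X, quantify Q (fun Y => p fun j => shift d
        ((Fin.cons X Y : Fin (Q.length + 1) → Config (Fin 2)) j)) ↔
        quantify Q fun Y => p (Fin.cons (shift d X) Y) := by
      intro X
      refine Iff.trans (iff_of_eq (congrArg _ (funext fun Y => congrArg p (funext fun j => ?_))))
        (ih fun Y => p (Fin.cons (shift d X) Y))
      refine Fin.cases rfl (fun i => ?_) j
      simp only [Fin.cons_succ]
    refine (q.interp_congr h).trans ?_
    cases q with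
    | all => exact ((shift_surjective d).forall
        (p := fun X => quantify Q fun Y => p (Fin.cons X Y))).symm
    | ex => exact ((shift_surjective d).exists
        (p := fun X => quantify Q fun Y => p (Fin.cons X Y))).symm

theorem Term.eval_add {l : ℕ} (t : Term l) (v : Fin l → ℤ × ℤ) (d : ℤ × ℤ) :
    t.eval (fun i => v i + d) = t.eval v + d := by
  induction t with
  | var i => rfl
  | app δ t ih =>
    rw [Term.eval, Term.eval, ih]
    cases δ <;> simp [Dir.move, Prod.ext_iff, add_right_comm, sub_add_eq_add_sub]

theorem QFFormula.holds_shift {m l : ℕ} (d : ℤ × ℤ) (x : Config A) (X : Fin m → Config (Fin 2))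
    (v : Fin l → ℤ × ℤ) (φ : QFFormula A m l) :
    φ.Holds (shift d x) (fun j => shift d (X j)) v ↔ φ.Holds x X fun i => v i + d := by
  induction φ with
  | eq t t' => simp [QFFormula.Holds, Term.eval_add]
  | symb a t => simp [QFFormula.Holds, Term.eval_add, shift]
  | conf j t b => simp [QFFormula.Holds, Term.eval_add, shift]
  | neg φ ih => exact not_congr ih
  | and φ ψ ih ih' => exact and_congr ih ih'
  | or φ ψ ih ih' => exact or_congr ih ih'

theorem Formula.shift_mem_modelSet (φ : Formula A) (d : ℤ × ℤ) (x : Config A) :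
    shift d x ∈ φ.modelSet ↔ x ∈ φ.modelSet := by
  refine (quantify_shift d φ.quants _).symm.trans (iff_of_eq (congrArg _ (funext fun X => ?_)))
  simp only [φ.matrix.holds_shift]
  refine propext ⟨fun h v => ?_, fun h v => h _⟩
  simpa using h fun i => v i + -d

/-- Nonmembership of `x` depends on its first `n` cells only, so by shift invariance the pattern on
these cells occurs nowhere in the set and can be forbidden. -/
theorem Formula.isSubshift_modelSet [Finite A] (φ : Formula A) : IsSubshift φ.modelSet := by
  obtain ⟨k, ⟨e⟩⟩ := Finite.exists_equiv_fin A
  obtain ⟨R, -, hR, -⟩ := φ.exists_primrecRel e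
  refine ⟨{P | P ∉ language φ.modelSet}, Set.ext fun x => ⟨fun hx P hP hPx => hP ⟨x, hx, hPx⟩,
    fun hx => ?_⟩⟩
  by_contra hxφ
  obtain ⟨n, hn⟩ := (hR x).1 hxφ
  classical
  let P : FinPattern A :=
    ⟨(Finset.range n).image cellOfIndex, fun w => x w⟩
  refine hx P ?_ ⟨0, fun w => by simp [P]⟩
  rintro ⟨y, hy, v, hv⟩
  refine (hR (shift v y)).2 ⟨n, ?_⟩ ((φ.shift_mem_modelSet v y).2 hy)
  have : initSeg n (codeConfig e (shift v y)) = initSeg n (codeConfig e x) := by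
    refine initSeg_congr fun i hi => ?_
    have := hv ⟨cellOfIndex i, Finset.mem_image_of_mem _ (Finset.mem_range.2 hi)⟩
    rw [codeConfig, codeConfig, shift, add_comm, this]
  rwa [this]

theorem REPred.exists_nat {α : Type*} [Primcodable α] {R : ℕ → α → Prop} (hR : PrimrecRel R) :
    REPred fun a => ∃ n, R n a := by
  classical
  have h : Computable₂ fun (a : α) (n : ℕ) => decide (R n a) :=
    (PrimrecRel.decide hR.swap).to_comp
  refine (Partrec.rfind (p := fun a => (fun n => Part.some (decide (R n a)) : ℕ →. Bool))
    h.partrec₂).dom_re.of_eq fun a => ?_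
  refine Nat.rfind_dom.trans ?_
  simp

/-- A list is not the code of a pattern in the language iff every configuration outside the
complement disagrees with it at the origin. Each alternative is visible on an initial segment, so
compactness turns "every configuration" into a finite check for some length. -/
theorem Formula.isPiZeroOne_language [Finite A] (φ : Formula A) :
    IsPiZeroOne (language φ.modelSet) := by
  obtain ⟨k, ⟨e⟩⟩ := Finite.exists_equiv_fin A
  refine ⟨k, e, ?_⟩
  obtain ⟨R, hR, hφ, hmono⟩ := φ.exists_primrecRel e
  -- Compactness is applied through words that extend to configurations, which needs a letter; over
  -- the empty alphabet there are no configurations.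
  rcases isEmpty_or_nonempty A with hA | hA
  · refine (REPred.exists_nat (R := fun _ _ => True) ?_).of_eq fun L => ?_
    · exact (Primrec.eq.comp (.const 0) (.const 0)).of_eq fun p => by simp
    · simp only [exists_const, true_iff]
      rintro ⟨P, ⟨x, -⟩, -⟩
      exact hA.elim (x 0)
  let T : List ((ℤ × ℤ) × Fin k) → ℕ → List ℕ → Prop := fun L n w =>
    R n w ∨ ∃ c ∈ L, cellIndex c.1 < n ∧ ¬ w.getD (cellIndex c.1) 0 = c.2
  have hlang : ∀ L : List ((ℤ × ℤ) × Fin k), (∃ P ∈ language φ.modelSet, P.IsCode e L) ↔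
      ∃ x ∈ φ.modelSet, ∀ c ∈ L, e (x c.1) = c.2 := by
    intro L
    constructor
    · rintro ⟨P, ⟨y, hy, v, hv⟩, hcode⟩
      refine ⟨shift v y, (φ.shift_mem_modelSet v y).2 hy, fun c hc => ?_⟩
      obtain ⟨h, hval⟩ := (hcode c.1 (e.symm c.2)).1 (by simpa using hc)
      have := hv ⟨c.1, h⟩
      rw [shift, add_comm, this, hval, e.apply_symm_apply]
    · rintro ⟨x, hx, hL⟩
      classical
      refine ⟨⟨(L.map Prod.fst).toFinset, fun w => x w⟩, ⟨x, hx, 0, fun w => by simp⟩,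
        fun v a => ?_⟩
      simp only [exists_prop, List.mem_toFinset, List.mem_map]
      constructor
      · intro h
        exact ⟨⟨_, h, rfl⟩, e.injective (hL _ h)⟩
      · rintro ⟨⟨c, hc, rfl⟩, rfl⟩
        rw [hL c hc]
        exact hc
  have hT : ∀ L, (∃ n, ∀ w ∈ words k n, T L n w) ↔
      ¬ ∃ P ∈ language φ.modelSet, P.IsCode e L := by
    intro L
    rw [hlang, ← forall_exists_initSeg_iff e (T L)]
    · push Not
      refine forall_congr' fun x => ⟨?_, fun h => ?_⟩
      · rintro ⟨n, h | ⟨c, hc, hlt, hne⟩⟩ hx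
        · exact absurd hx ((hφ x).2 ⟨n, h⟩)
        · rw [getD_initSeg hlt, codeConfig_cellIndex, Fin.val_inj] at hne
          exact ⟨c, hc, hne⟩
      · by_cases hx : x ∈ φ.modelSet
        · obtain ⟨c, hc, hne⟩ := h hx
          refine ⟨cellIndex c.1 + 1, .inr ⟨c, hc, Nat.lt_succ_self _, ?_⟩⟩
          rwa [getD_initSeg (Nat.lt_succ_self _), codeConfig_cellIndex, Fin.val_inj]
        · obtain ⟨n, hn⟩ := (hφ x).1 hx
          exact ⟨n, .inl hn⟩
    · rintro x n (h | ⟨c, hc, hlt, hne⟩)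
      · exact .inl (hmono x n h)
      · refine .inr ⟨c, hc, by omega, ?_⟩
        rw [getD_initSeg hlt] at hne
        rwa [getD_initSeg (by omega)]
  refine (REPred.exists_nat (R := fun n L => ∀ w ∈ words k n, T L n w) ?_).of_eq hT
  have h1 : PrimrecRel fun (c : (ℤ × ℤ) × Fin k) (p : ℕ × List ℕ) =>
      cellIndex c.1 < p.1 ∧ ¬ p.2.getD (cellIndex c.1) 0 = c.2 := by
    have hidx : Primrec fun q : ((ℤ × ℤ) × Fin k) × (ℕ × List ℕ) => cellIndex q.1.1 :=
      primrec_cellIndex.comp (Primrec.fst.comp .fst)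
    exact (Primrec.nat_lt.comp hidx (Primrec.fst.comp .snd)).and
      (Primrec.eq.comp ((Primrec.list_getD 0).comp (Primrec.snd.comp .snd) hidx)
        (Primrec.fin_val.comp (Primrec.snd.comp .fst))).not
  have h2 : PrimrecRel fun (w : List ℕ) (p : ℕ × List ((ℤ × ℤ) × Fin k)) => T p.2 p.1 w :=
    (hR.comp (Primrec.fst.comp .snd) .fst).or
      ((PrimrecRel.exists_mem_list h1).comp (Primrec.snd.comp .snd)
        ((Primrec.fst.comp .snd).pair .fst))
  exact (PrimrecRel.forall_mem_list h2).comp ((primrec_words k).comp .fst) .id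

theorem Formula.modelSet_mem_piZeroOne [Finite A] (φ : Formula A) :
    φ.modelSet ∈ piZeroOne A :=
  ⟨φ.isSubshift_modelSet, φ.isPiZeroOne_language⟩

end UMSO

theorem mainTheorem1 (A : Type u) [Finite A] :
    (∀ n : ℕ, 2 ≤ n → UMSO.piBar A n = UMSO.piZeroOne A) ∧
      (∀ n : ℕ, 3 ≤ n → UMSO.sigmaBar A n = UMSO.piZeroOne A) := by
  refine ⟨fun n hn => Set.Subset.antisymm ?_ ?_, fun n hn => Set.Subset.antisymm ?_ ?_⟩
  · rintro _ ⟨φ, -, rfl⟩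
    exact φ.modelSet_mem_piZeroOne
  · exact fun X hX => (UMSO.mem_levels_of_mem_piZeroOne hX).1 n hn
  · rintro _ ⟨φ, -, rfl⟩
    exact φ.modelSet_mem_piZeroOne
  · exact fun X hX => (UMSO.mem_levels_of_mem_piZeroOne hX).2 n hn
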